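/- Let $\phi:\mathbb{R}^2\to\mathbb{R}$ be a nonnegative, twice continuously differentiable, strictly convex function with Hessian matrix $H(\phi)$. Let $\sigma$ be the projection measure on the surface $\{(y,|y|^2+\phi(y)):y\in\mathbb{R}^2\}\subset\mathbb{R}^3$, that is, $\int g\,d\sigma=\int_{\mathbb{R}^2}g(y,|y|^2+\phi(y))\,dy$. For complex-valued $f\in L^2(\mathbb{R}^2)$, let $f\sigma$ be the measure with density $(y,t)\mapsto f(y)$ with respect to $\sigma$, let $f\sigma*f\sigma$ be its convolution with itself, and let $\|f\sigma*f\sigma\|_{L^2(\mathbb{R}^3)}$ be the $L^2$ norm of the density of this convolution with respect to Lebesgue measure. Put $$\mathcal{R}_\phi:=\sup_{0\neq f\in L^2(\mathbb{R}^2)}\frac{\|f\sigma*f\sigma\|_{L^2(\mathbb{R}^3)}^{1/2}}{\|f\|_{L^2(\mathbb{R}^2)}}.$$ A sequence $\{f_n\}\subset L^2(\mathbb{R}^2)$ is called *extremizing* if $\|f_n\|_{L^2}\le 1$ for every $n$ and $\|f_n\sigma*f_n\sigma\|_{L^2(\mathbb{R}^3)}\to\mathcal{R}_\phi^2$ as $n\to\infty$.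 It *concentrates along* a sequence $\{y_n\}\subset\mathbb{R}^2$ if for every $\varepsilon,\rho>0$ there exists $N\in\mathbb{N}$ such that, for every $n\ge N$, $$\int_{\{|y-y_n|\ge\rho\}}|f_n(y)|^2\,dy\le\varepsilon\|f_n\|_{L^2}^2,$$ and it *concentrates at* a point $y_0\in\mathbb{R}^2$ if this holds with $y_n=y_0$ for every $n$. Suppose that the set $E:=\{y\in\mathbb{R}^2: H(\phi)(y)=0\}$ is nonempty, and that there exist $r_0\ge 0$ and a function $\Theta:\mathbb{R}^2\to[0,\infty)$ such that $\inf_{\{|y|>r\}}\Theta(y)>0$ for every $r>r_0$ and such that the matrix $H(\phi)(y)-\Theta(y)I$ is positive semidefinite for every $y\in\mathbb{R}^2$. Then every extremizing sequence $\{f_n\}\subset L^2(\mathbb{R}^2)$ concentrates along a sequence of points of $E$. Moreover, given any subsequence of $\{f_n\}$, there exist a point $y_0\in E$ with $|y_0|\le r_0$ and a further subsequence of it which concentrates at $y_0$. -/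

import Mathlib

open MeasureTheory Filter Topology Set
open scoped ENNReal

namespace PerturbedParaboloid

noncomputable section

/-- The Euclidean plane `ℝ²`. -/
abbrev Plane : Type := EuclideanSpace ℝ (Fin 2)

/-- The space `L²(ℝ²)` of complex-valued square integrable functions. -/
abbrev L2Plane : Type := Lp ℂ 2 (volume : Measure Plane)

/-- The Hessian matrix `H(φ)(y)` of second order partial derivatives. -/
def hessian (φ : Plane → ℝ) (y : Plane) : Matrix (Fin 2) (Fin 2) ℝ :=
  Matrix.of fun i j =>
    fderiv ℝ (fderiv ℝ φ) y (EuclideanSpace.single i 1) (EuclideanSpace.single j 1)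

/-- The projection measure on the surface `{(y, |y|² + φ(y)) : y ∈ ℝ²}` of `ℝ² × ℝ`: the
push-forward of Lebesgue measure on `ℝ²` under the graph map `y ↦ (y, |y|² + φ(y))`. -/
def projMeasure (φ : Plane → ℝ) : Measure (Plane × ℝ) :=
  (volume : Measure Plane).map fun y => (y, ‖y‖ ^ 2 + φ y)

/-- `F` is the density, with respect to Lebesgue measure on `ℝ² × ℝ`, of the convolution
`fσ ∗ fσ`, where `σ` is the projection measure and `fσ` is the (locally finite, complex) measure
whose density with respect to `σ` is `(y, t) ↦ f y`. The convolution is the image of the product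
of `fσ` with itself under addition; it is tested against continuous functions with compact
support. -/
def IsConvDensity (φ : Plane → ℝ) (f : Plane → ℂ) (F : Plane × ℝ → ℂ) : Prop :=
  LocallyIntegrable F volume ∧
    ∀ h : Plane × ℝ → ℝ, Continuous h → HasCompactSupport h →
      ∫ p, h (p.1 + p.2) • (f p.1.1 * f p.2.1) ∂((projMeasure φ).prod (projMeasure φ)) =
        ∫ w, h w • F w

/-- The `L²(ℝ³)` norm of `fσ ∗ fσ`, as an extended nonnegative real. It is `∞` if `fσ ∗ fσ` has
no density; the density is unique up to null sets, so that the infimum is over equal numbers. -/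
def convNorm (φ : Plane → ℝ) (f : Plane → ℂ) : ℝ≥0∞ :=
  ⨅ (F : Plane × ℝ → ℂ) (_ : IsConvDensity φ f F), eLpNorm F 2 volume

/-- The optimal constant `R_φ = sup_{f ≠ 0} ‖fσ ∗ fσ‖^{1/2} / ‖f‖` of the inequality
`‖fσ ∗ fσ‖_{L²(ℝ³)} ≤ R_φ² ‖f‖²_{L²(ℝ²)}`, as an extended nonnegative real. -/
def bestConst (φ : Plane → ℝ) : ℝ≥0∞ :=
  ⨆ (f : L2Plane) (_ : f ≠ 0), convNorm φ f ^ (1 / 2 : ℝ) / ‖f‖ₑ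

/-- Extremizing sequences for the inequality `‖fσ ∗ fσ‖_{L²(ℝ³)} ≤ R_φ² ‖f‖²_{L²(ℝ²)}`. -/
def IsExtremizing (φ : Plane → ℝ) (f : ℕ → L2Plane) : Prop :=
  (∀ n, ‖f n‖ ≤ 1) ∧ Tendsto (fun n => convNorm φ (f n)) atTop (𝓝 (bestConst φ ^ 2))

/-- The sequence `f` concentrates along the sequence `y` of points of the plane. -/
def ConcentratesAlong (f : ℕ → L2Plane) (y : ℕ → Plane) : Prop :=
  ∀ ε > (0 : ℝ), ∀ ρ > (0 : ℝ), ∃ N : ℕ, ∀ n ≥ N,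
    ∫ x in {x : Plane | ρ ≤ ‖x - y n‖}, ‖f n x‖ ^ 2 ≤ ε * ‖f n‖ ^ 2

/-- The sequence `f` concentrates at the point `y₀`. -/
def ConcentratesAt (f : ℕ → L2Plane) (y₀ : Plane) : Prop :=
  ∀ ε > (0 : ℝ), ∀ ρ > (0 : ℝ), ∃ N : ℕ, ∀ n ≥ N,
    ∫ x in {x : Plane | ρ ≤ ‖x - y₀‖}, ‖f n x‖ ^ 2 ≤ ε * ‖f n‖ ^ 2

end

end PerturbedParaboloid

/-! The argument is a Cauchy–Schwarz inequality with a flexible weight. In the variables ξ = x + y,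
v = (x - y)/2, along each ray v = r·`dir θ` the height `psi φ x + psi φ y` has derivative 4r(1 +
gap), where `gap` measures the monotonicity of the gradient of φ and is nonnegative by convexity.
Hence `sumMap` pushes the measure (1 + gap)·β(x - y) dx dy forward to π/2 times Lebesgue measure on
`sumRegion`, for every degree-zero homogeneous β with circular mean one (`lintegral_sumMap_weight`).
Duality gives `convNorm_sq_le`: ‖fσ∗fσ‖² ≤ (π/2) ∬ |f(x)|²|f(y)|² / weight.

With β = 1 the weight is at least 1, so the fourth power of the best constant is at most π/2.
Truncated Gaussians shrinking to a zero of the Hessian show that it is at least π/2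
(`pi_div_two_le_bestConst_pow_four`). An extremizing sequence therefore loses nothing in the limit:
the product mass of any set where the weight is bounded away from 1 tends to zero.

The weight β = 1 already forces compactness. Strict convexity bounds the gap below off the diagonal
on bounded sets, and the lower bound Θ does so near infinity; Fubini and Bolzano–Weierstrass then
give a subsequence concentrating at some y₀ (`exists_subseq_concentratesAt`). This does not yet
force the Hessian to vanish at y₀, since a degenerate nonzero Hessian leaves directions with no
gain. There β is taken to be `quadWeight`, which moves weight towards the directions of small
curvature so that every direction gains by a fixed factor (`hessian_eq_zero_of_concentratesAt`).
Positivity of Θ beyond r₀ locates y₀, and a diagonal choice turns the subsequence statement into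
concentration along a sequence in E. -/

namespace PerturbedParaboloid

/-! ### Polar coordinates in the plane -/

/-- The unit vector with polar angle `θ`. -/
noncomputable def dir (θ : ℝ) : Plane := !₂[Real.cos θ, Real.sin θ]

lemma norm_dir (θ : ℝ) : ‖dir θ‖ = 1 := by
  simp [dir, EuclideanSpace.norm_eq]

lemma continuous_dir : Continuous dir := by
  unfold dir
  fun_prop

lemma lintegral_plane_polar {G : Plane → ℝ≥0∞} (hG : Measurable G) :
    ∫⁻ v, G v = ∫⁻ θ in Ioo (-Real.pi) Real.pi, ∫⁻ r in Ioi (0 : ℝ),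
      ENNReal.ofReal r * G (r • dir θ) := by
  have h1 := (PiLp.volume_preserving_toLp (Fin 2)).lintegral_comp hG
  have h2 := (volume_preserving_finTwoArrow ℝ).symm.lintegral_comp
    (f := fun v : Fin 2 → ℝ => G (WithLp.toLp 2 v))
    (hG.comp (PiLp.volume_preserving_toLp (Fin 2)).measurable)
  rw [← h1, ← h2, ← lintegral_comp_polarCoord_symm]
  rw [show polarCoord.target = Ioi (0 : ℝ) ×ˢ Ioo (-Real.pi) Real.pi from rfl,
    Measure.volume_eq_prod, ← Measure.prod_restrict, lintegral_prod_symm]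
  · refine lintegral_congr fun θ => lintegral_congr fun r => ?_
    simp only [smul_eq_mul, polarCoord_symm_apply]
    congr 2
    ext i
    fin_cases i <;> simp [dir]
  · apply Measurable.aemeasurable
    have : Measurable fun p : ℝ × ℝ => polarCoord.symm p :=
      continuous_polarCoord_symm.measurable
    refine (measurable_fst.ennreal_ofReal).smul ?_
    exact (hG.comp (PiLp.volume_preserving_toLp (Fin 2)).measurable).comp
      ((MeasurableEquiv.measurable _).comp this)

/-- Positively homogeneous weights of degree zero with mean one on the unit circle. -/
structure IsAngularWeight (β : Plane → ℝ) : Prop where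
  measurable : Measurable β
  half_le : ∀ v, 1 / 2 ≤ β v
  homog : ∀ r > (0 : ℝ), ∀ v, β (r • v) = β v
  mean : ∫⁻ θ in Ioo (-Real.pi) Real.pi, ENNReal.ofReal (β (dir θ)) = ENNReal.ofReal (2 * Real.pi)

/-- On each ray τ = γ(r·`dir θ`) is a legitimate change of variable with dτ = 4r w dr, and its range
Ioi (γ 0) does not depend on the angle. The angular integral of β then factors out, and 2π · 1/4 =
π/2. -/
lemma lintegral_radial {γ w β : Plane → ℝ} (hγ : Continuous γ) (hw : Measurable w)
    (hw0 : ∀ v, 0 ≤ w v) (hβ : IsAngularWeight β)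
    (hder : ∀ θ, ∀ r > 0, HasDerivAt (fun s : ℝ => γ (s • dir θ)) (4 * r * w (r • dir θ)) r)
    (hgrow : ∀ v, γ 0 + 2 * ‖v‖ ^ 2 ≤ γ v) {k : ℝ → ℝ≥0∞} (hk : Measurable k) :
    ∫⁻ v, k (γ v) * ENNReal.ofReal (w v * β v) =
      ENNReal.ofReal (Real.pi / 2) * ∫⁻ τ in Ioi (γ 0), k τ := by
  have hm : Measurable fun v => k (γ v) * ENNReal.ofReal (w v * β v) :=
    (hk.comp hγ.measurable).mul (hw.mul hβ.measurable).ennreal_ofReal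
  rw [lintegral_plane_polar hm]
  have inner : ∀ θ, ∫⁻ r in Ioi (0 : ℝ), ENNReal.ofReal r *
      (k (γ (r • dir θ)) * ENNReal.ofReal (w (r • dir θ) * β (r • dir θ))) =
      ENNReal.ofReal (β (dir θ)) * (ENNReal.ofReal (1 / 4) * ∫⁻ τ in Ioi (γ 0), k τ) := by
    intro θ
    have hβ0 : 0 ≤ β (dir θ) := by linarith [hβ.half_le (dir θ)]
    have hcont : Continuous fun s : ℝ => γ (s • dir θ) := by fun_prop
    have hmono : MonotoneOn (fun s : ℝ => γ (s • dir θ)) (Ioi 0) := by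
      apply monotoneOn_of_deriv_nonneg (convex_Ioi 0) hcont.continuousOn
      · intro r hr
        rw [interior_Ioi] at hr
        exact (hder θ r hr).differentiableAt.differentiableWithinAt
      · intro r hr
        rw [interior_Ioi] at hr
        rw [(hder θ r hr).deriv]
        have := hw0 (r • dir θ)
        have : (0 : ℝ) < r := hr
        positivity
    have himage : (fun s : ℝ => γ (s • dir θ)) '' Ioi 0 = Ioi (γ 0) := by
      apply Subset.antisymm
      · rintro _ ⟨r, hr, rfl⟩
        have h1 := hgrow (r • dir θ)
        rw [norm_smul, norm_dir, mul_one] at h1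
        have : 0 < ‖r‖ := norm_pos_iff.2 (ne_of_gt hr)
        simp only [mem_Ioi]
        nlinarith
      · intro t ht
        have ht : γ 0 < t := ht
        -- Since R ≥ 1, the growth bound gives γ ≥ γ 0 + 2R² ≥ t at radius R.
        set R := 1 + (t - γ 0) with hR
        have hR1 : 1 ≤ R := by linarith
        have h1 := hgrow (R • dir θ)
        rw [norm_smul, norm_dir, mul_one, Real.norm_of_nonneg (by linarith)] at h1
        have h2 : t ∈ Icc (γ ((0 : ℝ) • dir θ)) (γ (R • dir θ)) := by
          constructor
          · rw [zero_smul]; exact ht.le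
          · nlinarith
        obtain ⟨r, hr, hrt⟩ := intermediate_value_Icc (by linarith : (0 : ℝ) ≤ R)
          hcont.continuousOn h2
        refine ⟨r, lt_of_le_of_ne hr.1 ?_, hrt⟩
        rintro rfl
        simp at hrt
        linarith
    rw [← himage, lintegral_image_eq_lintegral_deriv_mul_of_monotoneOn measurableSet_Ioi
      (fun r hr => (hder θ r hr).hasDerivWithinAt) hmono, ← lintegral_const_mul',
      ← lintegral_const_mul']
    · refine setLIntegral_congr_fun measurableSet_Ioi fun r hr => ?_
      have hr : (0 : ℝ) < r := hr
      have h0 := hw0 (r • dir θ)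
      simp only [hβ.homog r hr]
      rw [mul_left_comm, ← ENNReal.ofReal_mul hr.le, ← mul_assoc (ENNReal.ofReal (1 / 4)),
        ← ENNReal.ofReal_mul (by norm_num), ← mul_assoc (ENNReal.ofReal (β (dir θ))),
        ← ENNReal.ofReal_mul hβ0, mul_comm]
      congr 2
      ring
    · exact ENNReal.ofReal_ne_top
    · exact ENNReal.ofReal_ne_top
  simp only [inner]
  have hm2 : Measurable fun θ => ENNReal.ofReal (β (dir θ)) :=
    (hβ.measurable.comp continuous_dir.measurable).ennreal_ofReal
  rw [lintegral_mul_const _ hm2, hβ.mean,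
    ← mul_assoc, ← ENNReal.ofReal_mul (by positivity)]
  congr 2
  ring

/-! ### The surface and the weighted convolution -/

/-- The function whose graph is the perturbed paraboloid. -/
noncomputable def psi (φ : Plane → ℝ) (y : Plane) : ℝ := ‖y‖ ^ 2 + φ y

/-- The sum of the points of the surface above `p.1` and `p.2`. -/
noncomputable def sumMap (φ : Plane → ℝ) (p : Plane × Plane) : Plane × ℝ :=
  (p.1 + p.2, psi φ p.1 + psi φ p.2)

/-- The normalised monotonicity gap of the gradient of `φ`; its value on the diagonal is
immaterial. -/
noncomputable def gap (φ : Plane → ℝ) (x y : Plane) : ℝ := by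
  classical
  exact if x = y then 1 else
    (fderiv ℝ φ x (x - y) - fderiv ℝ φ y (x - y)) / (2 * ‖x - y‖ ^ 2)

/-- The image of `sumMap φ`, up to a null set. -/
def sumRegion (φ : Plane → ℝ) : Set (Plane × ℝ) :=
  {w | 2 * psi φ ((1 / 2 : ℝ) • w.1) < w.2}

section

variable {φ : Plane → ℝ}

lemma continuous_psi (hφ : Continuous φ) : Continuous (psi φ) := by
  unfold psi
  fun_prop

lemma continuous_sumMap (hφ : Continuous φ) : Continuous (sumMap φ) := by
  have := continuous_psi hφ
  unfold sumMap
  fun_prop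

lemma measurableSet_sumRegion (hφ : Continuous φ) : MeasurableSet (sumRegion φ) := by
  have := continuous_psi hφ
  exact measurableSet_lt (by fun_prop) (by fun_prop)

lemma gap_of_ne {x y : Plane} (h : x ≠ y) : gap φ x y =
    (fderiv ℝ φ x (x - y) - fderiv ℝ φ y (x - y)) / (2 * ‖x - y‖ ^ 2) := if_neg h

lemma measurable_gap (hφ : ContDiff ℝ 1 φ) :
    Measurable fun p : Plane × Plane => gap φ p.1 p.2 := by
  have h := hφ.continuous_fderiv one_ne_zero
  unfold gap
  refine Measurable.ite (measurableSet_eq_fun measurable_fst measurable_snd) measurable_const ?_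
  refine Measurable.div ?_ (by fun_prop)
  apply Continuous.measurable
  fun_prop

lemma fderiv_le_sub (hφ : ContDiff ℝ 1 φ) (hc : ConvexOn ℝ univ φ) (x y : Plane) :
    fderiv ℝ φ y (x - y) ≤ φ x - φ y := by
  set g : ℝ → ℝ := fun t => φ (y + t • (x - y)) with hg
  have hd : HasDerivAt g (fderiv ℝ φ y (x - y)) 0 := by
    have h1 : HasDerivAt (fun t : ℝ => y + t • (x - y)) (x - y) 0 := by
      simpa using ((hasDerivAt_id (0 : ℝ)).smul_const (x - y)).const_add y
    have h2 : HasFDerivAt φ (fderiv ℝ φ y) (y + (0 : ℝ) • (x - y)) := by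
      simpa using ((hφ.differentiable one_ne_zero) y).hasFDerivAt
    exact h2.comp_hasDerivAt (0 : ℝ) h1
  have hcg : ConvexOn ℝ univ g := by
    have h := hc.comp_affineMap (AffineMap.lineMap y x : ℝ →ᵃ[ℝ] Plane)
    have h2 : φ ∘ (AffineMap.lineMap y x : ℝ →ᵃ[ℝ] Plane) = g := by
      ext t
      simp [hg, AffineMap.lineMap_apply, add_comm]
    rwa [h2, preimage_univ] at h
  have h3 := hcg.le_slope_of_hasDerivAt (mem_univ 0) (mem_univ 1) zero_lt_one hd
  simpa [slope, hg] using h3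

lemma gap_nonneg (hφ : ContDiff ℝ 1 φ) (hc : ConvexOn ℝ univ φ) (x y : Plane) :
    0 ≤ gap φ x y := by
  by_cases h : x = y
  · simp [gap, h]
  · rw [gap_of_ne h]
    refine div_nonneg ?_ (by positivity)
    have h1 := fderiv_le_sub hφ hc x y
    have h2 := fderiv_le_sub hφ hc y x
    have h3 : fderiv ℝ φ x (y - x) = - fderiv ℝ φ x (x - y) := by
      rw [← map_neg, neg_sub]
    linarith

lemma two_mul_midpoint_le (hc : ConvexOn ℝ univ φ) (u v : Plane) :
    2 * φ u ≤ φ (u + v) + φ (u - v) := by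
  have h := hc.2 (mem_univ (u + v)) (mem_univ (u - v)) (by norm_num : (0 : ℝ) ≤ 1 / 2)
    (by norm_num : (0 : ℝ) ≤ 1 / 2) (by norm_num)
  have h2 : (1 / 2 : ℝ) • (u + v) + (1 / 2 : ℝ) • (u - v) = u := by
    module
  rw [h2] at h
  simp only [smul_eq_mul] at h
  linarith

lemma psi_add_psi (u v : Plane) : psi φ (u + v) + psi φ (u - v) =
    2 * ‖u‖ ^ 2 + 2 * ‖v‖ ^ 2 + (φ (u + v) + φ (u - v)) := by
  have := parallelogram_law_with_norm ℝ u v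
  unfold psi
  nlinarith

lemma hasDerivAt_psi_add_psi (hφ : ContDiff ℝ 1 φ) (u : Plane) (θ : ℝ) {r : ℝ} (hr : 0 < r) :
    HasDerivAt (fun s : ℝ => psi φ (u + s • dir θ) + psi φ (u - s • dir θ))
      (4 * r * (1 + gap φ (u + r • dir θ) (u - r • dir θ))) r := by
  have hf : (fun s : ℝ => psi φ (u + s • dir θ) + psi φ (u - s • dir θ)) =
      fun s => 2 * ‖u‖ ^ 2 + 2 * s ^ 2 + (φ (u + s • dir θ) + φ (u - s • dir θ)) := by
    ext s
    rw [psi_add_psi, norm_smul, norm_dir, mul_one, Real.norm_eq_abs, sq_abs]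
  rw [hf]
  have hdiff := hφ.differentiable one_ne_zero
  have h1 : HasDerivAt (fun s : ℝ => u + s • dir θ) (dir θ) r := by
    simpa using ((hasDerivAt_id r).smul_const (dir θ)).const_add u
  have h2 : HasDerivAt (fun s : ℝ => u - s • dir θ) (-dir θ) r := by
    simpa using ((hasDerivAt_id r).smul_const (dir θ)).const_sub u
  have h3 := (hdiff (u + r • dir θ)).hasFDerivAt.comp_hasDerivAt r h1
  have h4 := (hdiff (u - r • dir θ)).hasFDerivAt.comp_hasDerivAt r h2
  have h5 : HasDerivAt (fun s : ℝ => 2 * ‖u‖ ^ 2 + 2 * s ^ 2) (4 * r) r := by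
    refine (((hasDerivAt_pow 2 r).const_mul 2).const_add (2 * ‖u‖ ^ 2)).congr_deriv ?_
    norm_num
    ring
  refine (h5.add (h3.add h4)).congr_deriv ?_
  have hv : (u + r • dir θ) - (u - r • dir θ) = (2 * r) • dir θ := by module
  have hne : u + r • dir θ ≠ u - r • dir θ := by
    rw [← sub_ne_zero, hv, ← norm_ne_zero_iff, norm_smul, norm_dir]
    simp [hr.ne']
  rw [gap_of_ne hne, hv, norm_smul, norm_dir, Real.norm_of_nonneg (by positivity)]
  simp only [map_smul, map_neg, smul_eq_mul]
  field_simp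
  ring

lemma lintegral_prod_eq_lintegral_midpoint {G : Plane × Plane → ℝ≥0∞} (hG : Measurable G) :
    ∫⁻ p : Plane × Plane, G p =
      ∫⁻ ξ : Plane, ∫⁻ v : Plane, G ((1 / 2 : ℝ) • ξ + v, (1 / 2 : ℝ) • ξ - v) := by
  rw [Measure.volume_eq_prod, lintegral_prod _ hG.aemeasurable]
  have h1 : ∀ x : Plane, ∫⁻ y, G (x, y) = ∫⁻ ξ, G (x, ξ - x) := fun x =>
    (lintegral_sub_right_eq_self (fun y => G (x, y)) x).symm
  simp only [h1]
  rw [lintegral_lintegral_swap]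
  · refine lintegral_congr fun ξ => ?_
    rw [← lintegral_add_left_eq_self _ ((1 / 2 : ℝ) • ξ)]
    refine lintegral_congr fun v => ?_
    congr 2
    module
  · apply Measurable.aemeasurable
    exact hG.comp (by fun_prop)

/-- For fixed ξ = x + y this is `lintegral_radial` in the half-difference v. Homogeneity of β
absorbs the factor in x - y = 2v, and the range in τ starts at twice the height over the midpoint.
-/
theorem lintegral_sumMap_weight (hφ : ContDiff ℝ 1 φ) (hc : ConvexOn ℝ univ φ) {β : Plane → ℝ}
    (hβ : IsAngularWeight β) {H : Plane × ℝ → ℝ≥0∞} (hH : Measurable H) :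
    ∫⁻ p : Plane × Plane, H (sumMap φ p) *
        ENNReal.ofReal ((1 + gap φ p.1 p.2) * β (p.1 - p.2)) =
      ENNReal.ofReal (Real.pi / 2) * ∫⁻ w in sumRegion φ, H w := by
  have hcont := hφ.continuous
  have hψ := continuous_psi hcont
  have hmeas : Measurable fun p : Plane × Plane => H (sumMap φ p) *
      ENNReal.ofReal ((1 + gap φ p.1 p.2) * β (p.1 - p.2)) := by
    refine (hH.comp (continuous_sumMap hcont).measurable).mul ?_
    refine Measurable.ennreal_ofReal ?_
    exact (measurable_const.add (measurable_gap hφ)).mul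
      (hβ.measurable.comp (measurable_fst.sub measurable_snd))
  rw [lintegral_prod_eq_lintegral_midpoint hmeas]
  have hinner : ∀ ξ : Plane, ∫⁻ v : Plane,
      H (sumMap φ ((1 / 2 : ℝ) • ξ + v, (1 / 2 : ℝ) • ξ - v)) *
        ENNReal.ofReal ((1 + gap φ ((1 / 2 : ℝ) • ξ + v) ((1 / 2 : ℝ) • ξ - v)) *
          β (((1 / 2 : ℝ) • ξ + v) - ((1 / 2 : ℝ) • ξ - v))) =
      ENNReal.ofReal (Real.pi / 2) *
        ∫⁻ τ in Ioi (2 * psi φ ((1 / 2 : ℝ) • ξ)), H (ξ, τ) := by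
    intro ξ
    set u := (1 / 2 : ℝ) • ξ with hu
    have key := lintegral_radial (γ := fun v => psi φ (u + v) + psi φ (u - v))
      (w := fun v => 1 + gap φ (u + v) (u - v)) (β := β) (by fun_prop)
      (measurable_const.add ((measurable_gap hφ).comp (g := fun p : Plane × Plane => gap φ p.1 p.2)
        (f := fun v => (u + v, u - v)) (by fun_prop)))
      (fun v => by linarith [gap_nonneg hφ hc (u + v) (u - v)]) hβ
      (fun θ r hr => hasDerivAt_psi_add_psi hφ u θ hr)
      (fun v => by
        have := two_mul_midpoint_le hc u v
        rw [psi_add_psi, psi_add_psi, add_zero, sub_zero, norm_zero]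
        linarith)
      (k := fun τ => H (ξ, τ)) (hH.comp (by fun_prop))
    have h0 : psi φ (u + 0) + psi φ (u - 0) = 2 * psi φ u := by
      rw [add_zero, sub_zero]; ring
    simp only [h0] at key
    rw [← key]
    refine lintegral_congr fun v => ?_
    have hs : (u + v) - (u - v) = (2 : ℝ) • v := by module
    have hξ : (u + v) + (u - v) = ξ := by rw [hu]; module
    simp only [sumMap, hs, hβ.homog 2 two_pos, hξ]
  simp only [hinner]
  rw [lintegral_const_mul']
  · congr 1
    rw [← lintegral_indicator (measurableSet_sumRegion hcont), Measure.volume_eq_prod,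
      lintegral_prod _ (hH.indicator (measurableSet_sumRegion hcont)).aemeasurable]
    refine lintegral_congr fun ξ => ?_
    rw [← lintegral_indicator measurableSet_Ioi]
    rfl
  · exact ENNReal.ofReal_ne_top

end

/-! ### The upper bound for the convolution -/

lemma eLpNorm_two_sq {X E : Type*} [MeasurableSpace X] [NormedAddCommGroup E] (g : X → E)
    (μ : Measure X) : eLpNorm g 2 μ ^ 2 = ∫⁻ x, ‖g x‖ₑ ^ 2 ∂μ := by
  have h := eLpNorm_nnreal_pow_eq_lintegral (f := g) (μ := μ) (p := 2) two_ne_zero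
  simpa using h

/-- Composition with T is an isometry of L² spaces; F is the image of g under its adjoint, which has
norm at most one. -/
lemma exists_density_of_measurePreserving {X Y : Type*} [MeasurableSpace X] [MeasurableSpace Y]
    {T : X → Y} {M : Measure X} {ν : Measure Y} (hT : MeasurePreserving T M ν) {g : X → ℂ}
    (hg : MemLp g 2 M) :
    ∃ F : Y → ℂ, MemLp F 2 ν ∧ eLpNorm F 2 ν ≤ eLpNorm g 2 M ∧
      ∀ h : Y → ℝ, MemLp h 2 ν → ∫ x, h (T x) • g x ∂M = ∫ y, h y • F y ∂ν := by
  let A : Lp ℂ 2 ν →L[ℂ] Lp ℂ 2 M :=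
    (Lp.compMeasurePreservingₗᵢ ℂ T hT).toContinuousLinearMap
  have hA : ∀ u, ‖A u‖ = ‖u‖ := fun u => (Lp.compMeasurePreservingₗᵢ ℂ T hT).norm_map u
  let G : Lp ℂ 2 M := hg.toLp g
  let F : Lp ℂ 2 ν := ContinuousLinearMap.adjoint A G
  have hF : ‖F‖ ≤ ‖G‖ := by
    have h1 : ‖ContinuousLinearMap.adjoint A‖ ≤ 1 := by
      rw [LinearIsometryEquiv.norm_map]
      exact A.opNorm_le_bound zero_le_one fun u => by rw [hA, one_mul]
    calc ‖F‖ ≤ ‖ContinuousLinearMap.adjoint A‖ * ‖G‖ := ContinuousLinearMap.le_opNorm _ _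
      _ ≤ 1 * ‖G‖ := by gcongr
      _ = ‖G‖ := one_mul _
  refine ⟨F, Lp.memLp F, ?_, fun h hh => ?_⟩
  · rw [Lp.norm_def, Lp.norm_def, ENNReal.toReal_le_toReal (Lp.eLpNorm_ne_top _)
      (Lp.eLpNorm_ne_top _)] at hF
    rwa [eLpNorm_congr_ae hg.coeFn_toLp] at hF
  · have hh' : MemLp (fun y => (h y : ℂ)) 2 ν := hh.ofReal
    let U : Lp ℂ 2 ν := hh'.toLp _
    have key : inner ℂ U F = inner ℂ (A U) G := ContinuousLinearMap.adjoint_inner_right A U G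
    rw [L2.inner_def, L2.inner_def] at key
    have e1 : ∫ y, inner ℂ (U y) (F y) ∂ν = ∫ y, h y • F y ∂ν := by
      refine integral_congr_ae ?_
      filter_upwards [hh'.coeFn_toLp] with y hy
      rw [hy]
      simp [mul_comm]
    have e2 : ∫ x, inner ℂ (A U x) (G x) ∂M = ∫ x, h (T x) • g x ∂M := by
      refine integral_congr_ae ?_
      have h1 : (A U : X → ℂ) =ᵐ[M] fun x => (h (T x) : ℂ) :=
        (hh'.comp_measurePreserving hT).coeFn_toLp
      filter_upwards [h1, hg.coeFn_toLp] with x hx hx2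
      rw [hx, hx2]
      simp [mul_comm]
    rw [← e1, ← e2, key]

/-- The weight in the refined Cauchy–Schwarz inequality. -/
noncomputable def weight (φ β : Plane → ℝ) (p : Plane × Plane) : ℝ :=
  (1 + gap φ p.1 p.2) * β (p.1 - p.2)

/-- The measure `|f|² dy`. -/
noncomputable def massMeasure (f : Plane → ℂ) : Measure Plane :=
  volume.withDensity fun y => ‖f y‖ₑ ^ 2

section

variable {φ β : Plane → ℝ}

lemma half_le_weight (hφ : ContDiff ℝ 1 φ) (hc : ConvexOn ℝ univ φ) (hβ : IsAngularWeight β)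
    (p : Plane × Plane) : 1 / 2 ≤ weight φ β p := by
  have h1 := gap_nonneg hφ hc p.1 p.2
  have h2 := hβ.half_le (p.1 - p.2)
  unfold weight
  nlinarith

lemma measurable_weight (hφ : ContDiff ℝ 1 φ) (hβ : IsAngularWeight β) :
    Measurable (weight φ β) :=
  (measurable_const.add (measurable_gap hφ)).mul
      (hβ.measurable.comp (measurable_fst.sub measurable_snd))

lemma measurePreserving_sumMap (hφ : ContDiff ℝ 1 φ) (hc : ConvexOn ℝ univ φ)
    (hβ : IsAngularWeight β) :
    MeasurePreserving (sumMap φ)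
      ((volume : Measure (Plane × Plane)).withDensity fun p => ENNReal.ofReal (weight φ β p))
      (ENNReal.ofReal (Real.pi / 2) • volume.restrict (sumRegion φ)) := by
  have hm := (continuous_sumMap hφ.continuous).measurable
  refine ⟨hm, Measure.ext_of_lintegral _ fun H hH => ?_⟩
  have hHT : Measurable fun p => H (sumMap φ p) := hH.comp hm
  rw [lintegral_map hH hm, lintegral_withDensity_eq_lintegral_mul _
    (measurable_weight hφ hβ).ennreal_ofReal hHT, lintegral_smul_measure, smul_eq_mul,
    ← lintegral_sumMap_weight hφ hc hβ hH]
  refine lintegral_congr fun p => ?_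
  simp only [Pi.mul_apply, weight, mul_comm]

lemma massMeasure_univ (f : L2Plane) : massMeasure f univ = ‖f‖ₑ ^ 2 := by
  rw [massMeasure, withDensity_apply _ MeasurableSet.univ, Measure.restrict_univ,
    ← eLpNorm_two_sq, Lp.enorm_def]

lemma measurable_enorm_sq (f : L2Plane) : Measurable fun y => ‖f y‖ₑ ^ 2 :=
  (Lp.stronglyMeasurable f).measurable.enorm.pow_const 2

instance (f : L2Plane) : IsFiniteMeasure (massMeasure f) :=
  ⟨by rw [massMeasure_univ]; exact ENNReal.pow_lt_top enorm_lt_top⟩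

lemma lintegral_massMeasure_prod (f : L2Plane) {G : Plane × Plane → ℝ≥0∞} (hG : Measurable G) :
    ∫⁻ p, G p ∂((massMeasure f).prod (massMeasure f)) =
      ∫⁻ p : Plane × Plane, ‖f p.1‖ₑ ^ 2 * ‖f p.2‖ₑ ^ 2 * G p := by
  have hf := measurable_enorm_sq f
  rw [massMeasure, prod_withDensity hf hf, ← Measure.volume_eq_prod,
    lintegral_withDensity_eq_lintegral_mul _ (by fun_prop) hG]
  rfl

lemma integral_projMeasure_prod (hφ : Continuous φ) (f : L2Plane) {h : Plane × ℝ → ℝ}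
    (hh : Continuous h) :
    ∫ p, h (p.1 + p.2) • (f p.1.1 * f p.2.1) ∂((projMeasure φ).prod (projMeasure φ)) =
      ∫ p : Plane × Plane, h (sumMap φ p) • (f p.1 * f p.2) := by
  have hm : Measurable fun y : Plane => (y, ‖y‖ ^ 2 + φ y) := by fun_prop
  have hf := Lp.stronglyMeasurable f
  rw [projMeasure, Measure.map_prod_map _ _ hm hm, integral_map (hm.prodMap hm).aemeasurable,
    ← Measure.volume_eq_prod]
  · rfl
  · refine StronglyMeasurable.aestronglyMeasurable ?_
    have hc : Continuous fun p : (Plane × ℝ) × (Plane × ℝ) => h (p.1 + p.2) := by fun_prop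
    refine hc.stronglyMeasurable.smul ?_
    exact (hf.comp_measurable (measurable_fst.comp measurable_fst)).mul
      (hf.comp_measurable (measurable_fst.comp measurable_snd))

/-- The tensor product f ⊗ f is divided by the weight and the volume multiplied by it. The pairing
with h is unchanged, but `sumMap` is now measure preserving, so the adjoint produces a density whose
norm is controlled. The freedom in β is used in `hessian_eq_zero_of_concentratesAt`. -/
theorem convNorm_sq_le (hφ : ContDiff ℝ 1 φ) (hc : ConvexOn ℝ univ φ) (hβ : IsAngularWeight β)
    (f : L2Plane) :
    convNorm φ f ^ 2 ≤ ENNReal.ofReal (Real.pi / 2) *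
      ∫⁻ p, (ENNReal.ofReal (weight φ β p))⁻¹ ∂((massMeasure f).prod (massMeasure f)) := by
  have hw := half_le_weight hφ hc hβ
  have hwm := measurable_weight hφ hβ
  have hf := Lp.stronglyMeasurable f
  have hT := measurePreserving_sumMap hφ hc hβ
  set M := (volume : Measure (Plane × Plane)).withDensity fun p => ENNReal.ofReal (weight φ β p)
    with hM
  set ν := ENNReal.ofReal (Real.pi / 2) • (volume : Measure (Plane × ℝ)).restrict (sumRegion φ)
    with hν
  set g : Plane × Plane → ℂ := fun p => (weight φ β p)⁻¹ • (f p.1 * f p.2) with hg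
  have hff : StronglyMeasurable fun p : Plane × Plane => f p.1 * f p.2 :=
    (hf.comp_measurable measurable_fst).mul (hf.comp_measurable measurable_snd)
  have hgm : StronglyMeasurable g := hwm.inv.stronglyMeasurable.smul hff
  have hgnorm : eLpNorm g 2 M ^ 2 =
      ∫⁻ p, (ENNReal.ofReal (weight φ β p))⁻¹ ∂((massMeasure f).prod (massMeasure f)) := by
    have hinv : Measurable fun p => (ENNReal.ofReal (weight φ β p))⁻¹ := hwm.ennreal_ofReal.inv
    rw [eLpNorm_two_sq, lintegral_massMeasure_prod _ hinv, hM,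
      lintegral_withDensity_eq_lintegral_mul _ hwm.ennreal_ofReal (by fun_prop)]
    refine lintegral_congr fun p => ?_
    have hpos : 0 < weight φ β p := by linarith [hw p]
    have h0 : ENNReal.ofReal (weight φ β p) ≠ 0 := by simpa using hpos
    simp only [Pi.mul_apply, hg, enorm_smul, enorm_mul]
    rw [Real.enorm_of_nonneg (by positivity), ENNReal.ofReal_inv_of_pos hpos]
    calc ENNReal.ofReal (weight φ β p) *
          ((ENNReal.ofReal (weight φ β p))⁻¹ * (‖f p.1‖ₑ * ‖f p.2‖ₑ)) ^ 2
        = (ENNReal.ofReal (weight φ β p) * (ENNReal.ofReal (weight φ β p))⁻¹) *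
          ((ENNReal.ofReal (weight φ β p))⁻¹ * (‖f p.1‖ₑ ^ 2 * ‖f p.2‖ₑ ^ 2)) := by ring
      _ = ‖f p.1‖ₑ ^ 2 * ‖f p.2‖ₑ ^ 2 * (ENNReal.ofReal (weight φ β p))⁻¹ := by
        rw [ENNReal.mul_inv_cancel h0 ENNReal.ofReal_ne_top, one_mul, mul_comm]
  have hgfin : eLpNorm g 2 M < ∞ := by
    have h1 : eLpNorm g 2 M ^ 2 < ∞ := by
      rw [hgnorm]
      calc ∫⁻ p, (ENNReal.ofReal (weight φ β p))⁻¹ ∂((massMeasure f).prod (massMeasure f))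
          ≤ ∫⁻ _, 2 ∂((massMeasure f).prod (massMeasure f)) := by
            refine lintegral_mono fun p => ?_
            rw [ENNReal.inv_le_iff_inv_le, ← ENNReal.ofReal_ofNat, ← ENNReal.ofReal_inv_of_pos
              two_pos]
            exact ENNReal.ofReal_le_ofReal (by linarith [hw p])
        _ < ∞ := by
            rw [lintegral_const]
            exact ENNReal.mul_lt_top (by simp) (measure_lt_top _ _)
    exact lt_top_iff_ne_top.2 fun h => by simp [h] at h1
  obtain ⟨F, hF, hFnorm, hFint⟩ := exists_density_of_measurePreserving hT
    (g := g) ⟨hgm.aestronglyMeasurable, hgfin⟩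
  have hS := measurableSet_sumRegion hφ.continuous
  have hFrestr : AEStronglyMeasurable F (volume.restrict (sumRegion φ)) := by
    have h1 := hF.aestronglyMeasurable
    refine h1.mono_ac ?_
    exact Measure.absolutelyContinuous_smul (by simp [Real.pi_pos])
  -- F is a density relative to ν; the factor π/2 and the indicator convert it to one relative to
  -- Lebesgue measure.
  set D : Plane × ℝ → ℂ := (sumRegion φ).indicator fun w => (Real.pi / 2 : ℝ) • F w with hD
  have hDm : AEStronglyMeasurable D volume := by
    rw [hD, aestronglyMeasurable_indicator_iff hS]
    exact hFrestr.const_smul (Real.pi / 2)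
  have hDnorm : eLpNorm D 2 volume ^ 2 = ENNReal.ofReal (Real.pi / 2) * eLpNorm F 2 ν ^ 2 := by
    have hp : ENNReal.ofReal (Real.pi / 2) ≠ ∞ := ENNReal.ofReal_ne_top
    rw [hD, eLpNorm_indicator_eq_eLpNorm_restrict hS, eLpNorm_two_sq, eLpNorm_two_sq, hν,
      lintegral_smul_measure, smul_eq_mul, ← lintegral_const_mul' _ _ hp,
      ← lintegral_const_mul' _ _ hp]
    refine lintegral_congr fun w => ?_
    rw [enorm_smul, Real.enorm_of_nonneg (by positivity), mul_pow, pow_two (ENNReal.ofReal _),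
      mul_assoc]
  have hDfin : MemLp D 2 volume := by
    refine ⟨hDm, lt_top_iff_ne_top.2 fun h => ?_⟩
    rw [h] at hDnorm
    have h1 : ENNReal.ofReal (Real.pi / 2) * eLpNorm F 2 ν ^ 2 < ∞ :=
      ENNReal.mul_lt_top ENNReal.ofReal_lt_top (ENNReal.pow_lt_top hF.2)
    rw [← hDnorm] at h1
    simp at h1
  have hconv : IsConvDensity φ f D := by
    refine ⟨hDfin.locallyIntegrable one_le_two, fun h hh hs => ?_⟩
    have hh2 : MemLp h 2 ν :=
      ((hh.memLp_of_hasCompactSupport hs).restrict _).smul_measure ENNReal.ofReal_ne_top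
    rw [integral_projMeasure_prod hφ.continuous f hh]
    have e1 := hFint h hh2
    have e2 : ∫ p, h (sumMap φ p) • g p ∂M = ∫ p, h (sumMap φ p) • (f p.1 * f p.2) := by
      rw [hM, integral_withDensity_eq_integral_toReal_smul hwm.ennreal_ofReal (by simp)]
      refine integral_congr_ae (Eventually.of_forall fun p => ?_)
      have hpos : 0 < weight φ β p := by linarith [hw p]
      simp only [hg, ENNReal.toReal_ofReal hpos.le]
      rw [smul_comm (h _), smul_smul, mul_inv_cancel₀ hpos.ne', one_smul]
    have e3 : ∫ w, h w • D w = ∫ w, h w • F w ∂ν := by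
      rw [hν, integral_smul_measure, ENNReal.toReal_ofReal (by positivity), ← integral_smul,
        ← integral_indicator hS]
      refine integral_congr_ae (Eventually.of_forall fun w => ?_)
      by_cases hwS : w ∈ sumRegion φ
      · simp only [hD, indicator_of_mem hwS]
        rw [smul_comm]
      · simp only [hD, indicator_of_notMem hwS, smul_zero]
    rw [← e2, e1, e3]
  calc convNorm φ f ^ 2 ≤ eLpNorm D 2 volume ^ 2 := by
        gcongr
        exact iInf₂_le D hconv
    _ = ENNReal.ofReal (Real.pi / 2) * eLpNorm F 2 ν ^ 2 := hDnorm
    _ ≤ ENNReal.ofReal (Real.pi / 2) * eLpNorm g 2 M ^ 2 := by gcongr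
    _ = _ := by rw [hgnorm]

end

/-! ### The lower bound for the best constant -/

section

variable {φ : Plane → ℝ}

/-- By convexity the Taylor remainder is at most the increment of the derivative from y₀ to u
applied to u - y₀, and that increment is o(‖u - y₀‖) because the second derivative vanishes. -/
lemma sub_sub_fderiv_le_of_hessian_zero (hφ : ContDiff ℝ 2 φ) (hc : ConvexOn ℝ univ φ) {y₀ : Plane}
    (h0 : fderiv ℝ (fderiv ℝ φ) y₀ = 0) {η : ℝ} (hη : 0 < η) :
    ∃ ρ > 0, ∀ u, ‖u - y₀‖ ≤ ρ → φ u - φ y₀ - fderiv ℝ φ y₀ (u - y₀) ≤ η * ‖u - y₀‖ ^ 2 := by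
  have h1 : ContDiff ℝ 1 (fderiv ℝ φ) := hφ.fderiv_right (by norm_num)
  have hd : HasFDerivAt (fderiv ℝ φ) (0 : Plane →L[ℝ] Plane →L[ℝ] ℝ) y₀ := by
    have := (h1.differentiable one_ne_zero y₀).hasFDerivAt
    rwa [h0] at this
  have ho := hd.isLittleO.def hη
  obtain ⟨ρ, hρ, hball⟩ := Metric.eventually_nhds_iff.1 ho
  refine ⟨ρ / 2, by positivity, fun u hu => ?_⟩
  have h2 := hball (y := u) (by rw [dist_eq_norm]; linarith)
  simp only [zero_apply, sub_zero] at h2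
  have h3 := fderiv_le_sub (hφ.of_le (by norm_num)) hc y₀ u
  have h4 : fderiv ℝ φ u (y₀ - u) = - fderiv ℝ φ u (u - y₀) := by
    rw [← map_neg, neg_sub]
  have h5 : (fderiv ℝ φ u - fderiv ℝ φ y₀) (u - y₀) ≤ η * ‖u - y₀‖ * ‖u - y₀‖ := by
    refine (le_abs_self _).trans (((fderiv ℝ φ u - fderiv ℝ φ y₀).le_opNorm (u - y₀)).trans ?_)
    gcongr
  rw [sub_apply] at h5
  nlinarith

/-- Cauchy–Schwarz against a test function bounds every admissible density from below, hence also
the infimum. -/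
lemma enorm_integral_div_le_convNorm (hφ : Continuous φ) (f : L2Plane) {h : Plane × ℝ → ℝ}
    (hh : Continuous h) (hs : HasCompactSupport h) {N : ℝ≥0∞} (hN : eLpNorm h 2 volume ≤ N) :
    ‖∫ p : Plane × Plane, h (sumMap φ p) • (f p.1 * f p.2)‖ₑ / N ≤ convNorm φ f := by
  refine le_iInf₂ fun F hF => ENNReal.div_le_of_le_mul' ?_
  rw [← integral_projMeasure_prod hφ f hh, hF.2 h hh hs]
  calc ‖∫ w, h w • F w‖ₑ ≤ ∫⁻ w, ‖h w • F w‖ₑ := enorm_integral_le_lintegral_enorm _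
    _ = eLpNorm (h • F) 1 volume := by rw [eLpNorm_one_eq_lintegral_enorm]; rfl
    _ ≤ eLpNorm h 2 volume * eLpNorm F 2 volume :=
      eLpNorm_smul_le_mul_eLpNorm hF.1.aestronglyMeasurable hh.aestronglyMeasurable
    _ ≤ N * eLpNorm F 2 volume := by gcongr

lemma integrable_gaussian_plane {b : ℝ} (hb : 0 < b) (z : Plane) :
    Integrable fun u : Plane => Real.exp (-b * ‖u - z‖ ^ 2) := by
  have h := GaussianFourier.integrable_cexp_neg_mul_sq_norm_add (V := Plane) (b := (b : ℂ))
    (by simpa using hb) 0 0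
  have h2 := h.norm
  have h3 : Integrable fun u : Plane => Real.exp (-b * ‖u‖ ^ 2) := by
    refine h2.congr (Eventually.of_forall fun u => ?_)
    simp only [zero_mul, add_zero, Complex.norm_exp]
    congr 1
    norm_cast
  exact h3.comp_sub_right z

lemma integral_gaussian_plane {b : ℝ} (hb : 0 < b) (z : Plane) :
    ∫ u : Plane, Real.exp (-b * ‖u - z‖ ^ 2) = Real.pi / b := by
  rw [integral_sub_right_eq_self (fun u : Plane => Real.exp (-b * ‖u‖ ^ 2)) z,
    GaussianFourier.integral_rexp_neg_mul_sq_norm hb]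
  simp

/-- Outside the ball half of the exponent is spent on the factor exp(-bρ²/2); the other half still
integrates, to twice π/b. -/
lemma gaussian_ball_ge {b ρ : ℝ} (hb : 0 < b) (hρ : 0 < ρ) (z : Plane) :
    Real.pi / b * (1 - 2 * Real.exp (-(b / 2) * ρ ^ 2)) ≤
      ∫ u in Metric.closedBall z ρ, Real.exp (-b * ‖u - z‖ ^ 2) := by
  have hi := integrable_gaussian_plane hb z
  have h1 := integral_add_compl (Metric.isClosed_closedBall (x := z) (ε := ρ)).measurableSet hi
  rw [integral_gaussian_plane hb] at h1
  have h2 : ∫ u in (Metric.closedBall z ρ)ᶜ, Real.exp (-b * ‖u - z‖ ^ 2) ≤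
      Real.exp (-(b / 2) * ρ ^ 2) * (Real.pi / (b / 2)) := by
    rw [← integral_gaussian_plane (half_pos hb) z, ← integral_const_mul]
    have hi2 := (integrable_gaussian_plane (half_pos hb) z).const_mul
      (Real.exp (-(b / 2) * ρ ^ 2))
    refine le_trans (setIntegral_mono_on hi.integrableOn hi2.integrableOn
      Metric.isClosed_closedBall.measurableSet.compl fun u hu => ?_)
      (setIntegral_le_integral hi2 (Eventually.of_forall fun u => by positivity))
    rw [← Real.exp_add, Real.exp_le_exp]
    have : ρ < ‖u - z‖ := by simpa [dist_eq_norm] using hu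
    have : ρ ^ 2 ≤ ‖u - z‖ ^ 2 := by gcongr
    nlinarith
  have h3 : Real.pi / (b / 2) = 2 * (Real.pi / b) := by field_simp
  rw [h3] at h2
  nlinarith

/-- An `L²` bound for functions with exponential decay in height, supported above a paraboloid. -/
lemma eLpNorm_sq_le_of_le_exp_above_paraboloid {lam δ : ℝ} (hlam : 0 < lam) (z : Plane) {L : Plane → ℝ}
    {h : Plane × ℝ → ℝ} (hh : Measurable h)
    (hbound : ∀ w, ‖h w‖ ≤ Real.exp (-lam * (w.2 - L w.1)))
    (hzero : ∀ w, w.2 - L w.1 < ‖w.1 - z‖ ^ 2 / 2 - δ → h w = 0) :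
    eLpNorm h 2 volume ^ 2 ≤
      ENNReal.ofReal (Real.exp (2 * lam * δ) * (Real.pi / (2 * lam ^ 2))) := by
  rw [eLpNorm_two_sq, Measure.volume_eq_prod, lintegral_prod _ (by fun_prop)]
  have inner : ∀ ξ : Plane, ∫⁻ τ, ‖h (ξ, τ)‖ₑ ^ 2 ≤
      ENNReal.ofReal (Real.exp (2 * lam * δ) / (2 * lam) * Real.exp (-lam * ‖ξ - z‖ ^ 2)) := by
    intro ξ
    set c := L ξ + ‖ξ - z‖ ^ 2 / 2 - δ with hcdef
    have ha : -(2 * lam) < 0 := by linarith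
    let k : ℝ → ℝ≥0∞ := fun τ =>
      ENNReal.ofReal (Real.exp (2 * lam * L ξ) * Real.exp (-(2 * lam) * τ))
    have hle : ∀ τ, ‖h (ξ, τ)‖ₑ ^ 2 ≤ (Ici c).indicator k τ := by
      intro τ
      by_cases hτ : c ≤ τ
      · rw [indicator_of_mem (by exact hτ), ← ofReal_norm, ← ENNReal.ofReal_pow (norm_nonneg _)]
        apply ENNReal.ofReal_le_ofReal
        calc ‖h (ξ, τ)‖ ^ 2 ≤ Real.exp (-lam * (τ - L ξ)) ^ 2 := by
              gcongr
              exact hbound (ξ, τ)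
          _ = Real.exp (2 * lam * L ξ) * Real.exp (-(2 * lam) * τ) := by
              rw [← Real.exp_nat_mul, ← Real.exp_add]
              congr 1
              push_cast
              ring
      · rw [hzero (ξ, τ) (by simp only; linarith)]
        simp
    calc ∫⁻ τ, ‖h (ξ, τ)‖ₑ ^ 2 ≤ ∫⁻ τ, (Ici c).indicator k τ := lintegral_mono hle
      _ = ∫⁻ τ in Ioi c,
          ENNReal.ofReal (Real.exp (2 * lam * L ξ) * Real.exp (-(2 * lam) * τ)) := by
          rw [lintegral_indicator measurableSet_Ici, setLIntegral_congr Ioi_ae_eq_Ici]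
      _ = ENNReal.ofReal (∫ τ in Ioi c, Real.exp (2 * lam * L ξ) * Real.exp (-(2 * lam) * τ)) := by
          rw [ofReal_integral_eq_lintegral_ofReal
            ((integrableOn_exp_mul_Ioi ha c).const_mul _)
            (Eventually.of_forall fun τ => by positivity)]
      _ = ENNReal.ofReal
          (Real.exp (2 * lam * δ) / (2 * lam) * Real.exp (-lam * ‖ξ - z‖ ^ 2)) := by
          congr 1
          rw [integral_const_mul, integral_exp_mul_Ioi ha c, neg_div_neg_eq, mul_div_assoc',
            ← Real.exp_add, div_mul_eq_mul_div, ← Real.exp_add]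
          congr 2
          rw [hcdef]
          ring
  calc ∫⁻ ξ, ∫⁻ τ, ‖h (ξ, τ)‖ₑ ^ 2 ≤ ∫⁻ ξ : Plane,
      ENNReal.ofReal (Real.exp (2 * lam * δ) / (2 * lam) * Real.exp (-lam * ‖ξ - z‖ ^ 2)) :=
        lintegral_mono inner
    _ = ENNReal.ofReal (∫ ξ : Plane,
        Real.exp (2 * lam * δ) / (2 * lam) * Real.exp (-lam * ‖ξ - z‖ ^ 2)) := by
        rw [ofReal_integral_eq_lintegral_ofReal ((integrable_gaussian_plane hlam z).const_mul _)
            (Eventually.of_forall fun τ => by positivity)]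
    _ = _ := by
        rw [integral_const_mul, integral_gaussian_plane hlam z]
        congr 1
        field_simp

lemma bestConst_pow_four_ge {f : L2Plane} {A K : ℝ} (hA : 0 < A) (hK : 0 < K)
    (hf : ‖f‖ₑ ^ 2 = ENNReal.ofReal A) (hle : ENNReal.ofReal (A ^ 2 / √K) ≤ convNorm φ f) :
    ENNReal.ofReal (A ^ 2 / K) ≤ bestConst φ ^ 4 := by
  have hf0 : f ≠ 0 := by
    rintro rfl
    simp at hf
    linarith
  have h1 : convNorm φ f ^ (1 / 2 : ℝ) / ‖f‖ₑ ≤ bestConst φ :=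
    le_iSup₂ (f := fun (f : L2Plane) (_ : f ≠ 0) => convNorm φ f ^ (1 / 2 : ℝ) / ‖f‖ₑ) f hf0
  calc ENNReal.ofReal (A ^ 2 / K)
      = ENNReal.ofReal (A ^ 2 / √K) ^ 2 / ENNReal.ofReal A ^ 2 := by
        rw [← ENNReal.ofReal_pow (by positivity), ← ENNReal.ofReal_pow hA.le,
          ← ENNReal.ofReal_div_of_pos (by positivity), div_pow, Real.sq_sqrt hK.le]
        congr 1
        field_simp
    _ ≤ convNorm φ f ^ 2 / ENNReal.ofReal A ^ 2 := by gcongr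
    _ = (convNorm φ f ^ (1 / 2 : ℝ) / ‖f‖ₑ) ^ 4 := by
        rw [← hf, ← pow_mul, div_eq_mul_inv, div_eq_mul_inv, mul_pow, ENNReal.inv_pow,
          ← ENNReal.rpow_mul_natCast, ← ENNReal.rpow_natCast (convNorm φ f)]
        norm_num
    _ ≤ bestConst φ ^ 4 := by gcongr

/-- Near y₀ the surface is, up to an affine function, almost a paraboloid, for which Gaussians are
optimal. The trial function is exp(-lam·e) cut off to a ball, and it is tested against an h with h ∘
`sumMap` = f₀ ⊗ f₀ on that ball, so that the pairing equals A². -/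
lemma bestConst_pow_four_ge_of_hessian_zero (hφ : ContDiff ℝ 2 φ) (hc : ConvexOn ℝ univ φ)
    {y₀ : Plane} (h0 : fderiv ℝ (fderiv ℝ φ) y₀ = 0) {η : ℝ} (hη : 0 < η) (hη1 : η < 1) :
    ENNReal.ofReal (Real.pi / 2 * (Real.exp (-η) * ((1 - η) / (1 + η)) ^ 2)) ≤
      bestConst φ ^ 4 := by
  obtain ⟨ρ, hρ, hT⟩ := sub_sub_fderiv_le_of_hessian_zero hφ hc h0 hη
  have hcont := hφ.continuous
  -- Large enough that the Gaussian mass outside the ball of radius ρ is at most the fraction η of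
  -- the total.
  set lam := 2 / (η * ρ ^ 2) with hlamdef
  have hlam : 0 < lam := by positivity
  -- Makes the loss exp(2·lam·δ) from the width of the cutoff equal to exp η.
  set δ := η / (2 * lam) with hδdef
  have hδ : 0 < δ := by positivity
  set B := Metric.closedBall y₀ ρ with hB
  have hBm : MeasurableSet B := Metric.isClosed_closedBall.measurableSet
  have hBc : IsCompact B := isCompact_closedBall y₀ ρ
  set e : Plane → ℝ := fun u => ‖u - y₀‖ ^ 2 + (φ u - φ y₀ - fderiv ℝ φ y₀ (u - y₀)) with he
  have hec : Continuous e := by fun_prop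
  have he0 : ∀ u, ‖u - y₀‖ ^ 2 ≤ e u := fun u => by
    have := fderiv_le_sub (hφ.of_le (by norm_num)) hc u y₀
    simp only [he]
    linarith
  have he1 : ∀ u ∈ B, e u ≤ (1 + η) * ‖u - y₀‖ ^ 2 := fun u hu => by
    have := hT u (by simpa [hB, dist_eq_norm] using hu)
    simp only [he]
    linarith
  set f₀ : Plane → ℝ := B.indicator fun u => Real.exp (-lam * e u) with hf₀
  have hf₀m : Measurable f₀ := (Continuous.measurable (by fun_prop)).indicator hBm
  have hf₀b : ∀ u, ‖f₀ u‖ ≤ 1 := fun u => by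
    by_cases hu : u ∈ B
    · rw [hf₀, indicator_of_mem hu, Real.norm_of_nonneg (by positivity), Real.exp_le_one_iff]
      have := he0 u
      nlinarith [sq_nonneg ‖u - y₀‖]
    · rw [hf₀, indicator_of_notMem hu]
      simp
  have hfL : MemLp (fun u => (f₀ u : ℂ)) 2 volume := by
    have h1 : MemLp (B.indicator fun _ => (1 : ℝ)) 2 (volume : Measure Plane) :=
      memLp_indicator_const 2 hBm 1 (Or.inr hBc.measure_lt_top.ne)
    refine h1.of_le (by fun_prop) (Eventually.of_forall fun u => ?_)
    by_cases hu : u ∈ B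
    · rw [indicator_of_mem hu, norm_one, Complex.norm_real]
      exact hf₀b u
    · simp [hf₀, hu]
  set f : L2Plane := hfL.toLp _ with hf
  set A := ∫ u, f₀ u ^ 2 with hA
  have hf₀sq : Integrable fun u => f₀ u ^ 2 := by
    have := hfL.integrable_norm_pow two_ne_zero
    simpa using this
  have hfnorm : ‖f‖ₑ ^ 2 = ENNReal.ofReal A := by
    rw [hf, Lp.enorm_toLp, eLpNorm_two_sq, hA, ofReal_integral_eq_lintegral_ofReal hf₀sq
      (Eventually.of_forall fun u => sq_nonneg _)]
    refine lintegral_congr fun u => ?_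
    rw [← ofReal_norm, ← ENNReal.ofReal_pow (norm_nonneg _), Complex.norm_real, Real.norm_eq_abs,
      sq_abs]
  have hAge : Real.pi / (2 * lam * (1 + η)) * (1 - η) ≤ A := by
    have hb : 0 < 2 * lam * (1 + η) := by positivity
    have h1 := gaussian_ball_ge hb hρ y₀
    have h2 : 2 * Real.exp (-(2 * lam * (1 + η) / 2) * ρ ^ 2) ≤ η := by
      have h3 : 2 / η ≤ 2 * lam * (1 + η) / 2 * ρ ^ 2 := by
        have : 2 * lam * (1 + η) / 2 * ρ ^ 2 = 2 / η * (1 + η) := by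
          rw [hlamdef]; field_simp
        rw [this]
        have : 0 < 2 / η := by positivity
        nlinarith
      have h4 := Real.add_one_le_exp (2 * lam * (1 + η) / 2 * ρ ^ 2)
      have h5 : 2 / η ≤ Real.exp (2 * lam * (1 + η) / 2 * ρ ^ 2) := by linarith
      rw [neg_mul, Real.exp_neg, ← div_eq_mul_inv, div_le_iff₀ (Real.exp_pos _)]
      rwa [div_le_iff₀ hη, mul_comm] at h5
    have h6 : ∫ u in B, Real.exp (-(2 * lam * (1 + η)) * ‖u - y₀‖ ^ 2) ≤ A := by
      have h7 : A = ∫ u in B, f₀ u ^ 2 := by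
        rw [hA, setIntegral_eq_integral_of_forall_compl_eq_zero]
        intro u hu
        simp [hf₀, hu]
      rw [h7]
      refine setIntegral_mono_on (integrable_gaussian_plane hb y₀).integrableOn
        hf₀sq.integrableOn hBm fun u hu => ?_
      rw [hf₀, indicator_of_mem hu, ← Real.exp_nat_mul, Real.exp_le_exp]
      have := he1 u hu
      push_cast
      nlinarith
    refine le_trans ?_ (h1.trans h6)
    gcongr
  have hA0 : 0 < A := lt_of_lt_of_le (by
    have := Real.pi_pos
    have : 0 < 1 - η := by linarith
    positivity) hAge
  set z : Plane := (2 : ℝ) • y₀ with hz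
  -- The tangent plane contributes an affine function of x + y only, so e x + e y is a function of
  -- the point `sumMap φ (x, y)`.
  set L : Plane → ℝ := fun ξ => 2 * inner ℝ ξ y₀ - 2 * ‖y₀‖ ^ 2 + 2 * φ y₀ +
    fderiv ℝ φ y₀ (ξ - z) with hL
  have hLc : Continuous L := by fun_prop
  have hLe : ∀ x y, psi φ x + psi φ y - L (x + y) = e x + e y := fun x y => by
    have h1 : (x + y) - z = (x - y₀) + (y - y₀) := by rw [hz]; module
    simp only [psi, hL, he, h1, map_add, norm_sub_sq_real, inner_add_left]
    ring
  obtain ⟨χ, hχ1, -, hχs, hχI⟩ := exists_continuous_one_zero_of_isCompact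
    ((hBc.prod hBc).image (continuous_sumMap hcont)) isClosed_empty (disjoint_empty _)
  -- The middle factor is a continuous cutoff: 1 above the paraboloid of height ‖ξ - z‖²/2, where
  -- all sums of points of the surface lie, and 0 more than δ below it. The factor χ only makes the
  -- support compact.
  set h : Plane × ℝ → ℝ := fun w => Real.exp (-lam * (w.2 - L w.1)) *
    (max 0 (min 1 (1 + ((w.2 - L w.1) - ‖w.1 - z‖ ^ 2 / 2) / δ)) * χ w) with hh
  have hhc : Continuous h := by
    have := χ.continuous
    simp only [hh]
    fun_prop
  have hhs : HasCompactSupport h := (hχs.mul_left).mul_left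
  set K := Real.exp (2 * lam * δ) * (Real.pi / (2 * lam ^ 2)) with hK
  have hK0 : 0 < K := by
    have := Real.pi_pos
    positivity
  have hhn : eLpNorm h 2 volume ≤ ENNReal.ofReal √K := by
    have h1 := eLpNorm_sq_le_of_le_exp_above_paraboloid hlam (δ := δ) z hhc.measurable
      (fun w => by
        have hm : max 0 (min 1 (1 + ((w.2 - L w.1) - ‖w.1 - z‖ ^ 2 / 2) / δ)) ≤ 1 :=
          max_le zero_le_one (min_le_left _ _)
        rw [hh, norm_mul, Real.norm_of_nonneg (Real.exp_pos _).le,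
          Real.norm_of_nonneg (mul_nonneg (le_max_left _ _) (hχI w).1)]
        exact mul_le_of_le_one_right (Real.exp_pos _).le
          (mul_le_one₀ hm (hχI w).1 (hχI w).2))
      (fun w hw => by
        have h2 : 1 + ((w.2 - L w.1) - ‖w.1 - z‖ ^ 2 / 2) / δ ≤ 0 := by
          have : ((w.2 - L w.1) - ‖w.1 - z‖ ^ 2 / 2) / δ ≤ -1 := by
            rw [div_le_iff₀ hδ]
            linarith
          linarith
        have h3 : max 0 (min 1 (1 + ((w.2 - L w.1) - ‖w.1 - z‖ ^ 2 / 2) / δ)) = 0 :=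
          max_eq_left ((min_le_right _ _).trans h2)
        simp only [hh, h3]
        ring)
    rw [← hK, ← Real.sq_sqrt hK0.le, ENNReal.ofReal_pow (Real.sqrt_nonneg _)] at h1
    exact (ENNReal.pow_le_pow_left_iff two_ne_zero).1 h1
  have hhval : ∀ x ∈ B, ∀ y ∈ B, h (sumMap φ (x, y)) = f₀ x * f₀ y := by
    intro x hx y hy
    have h1 : χ (sumMap φ (x, y)) = 1 := hχ1 ⟨(x, y), ⟨hx, hy⟩, rfl⟩
    have h2 : ‖x + y - z‖ ^ 2 / 2 ≤ e x + e y := by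
      have h3 : x + y - z = (x - y₀) + (y - y₀) := by rw [hz]; module
      have h4 := parallelogram_law_with_norm ℝ (x - y₀) (y - y₀)
      rw [h3]
      nlinarith [he0 x, he0 y, sq_nonneg ‖x - y₀ - (y - y₀)‖]
    have h5 : max 0 (min 1 (1 + ((e x + e y) - ‖x + y - z‖ ^ 2 / 2) / δ)) = 1 := by
      rw [min_eq_left, max_eq_right zero_le_one]
      have : 0 ≤ ((e x + e y) - ‖x + y - z‖ ^ 2 / 2) / δ := div_nonneg (by linarith) hδ.le
      linarith
    simp only [hh, h1]
    simp only [sumMap, hLe, h5, hf₀, indicator_of_mem hx, indicator_of_mem hy, mul_one]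
    rw [← Real.exp_add]
    congr 1
    ring
  have hint : ∫ p : Plane × Plane, h (sumMap φ p) • (f p.1 * f p.2) = ((A ^ 2 : ℝ) : ℂ) := by
    have hae : (f : Plane → ℂ) =ᵐ[volume] fun u => (f₀ u : ℂ) := hfL.coeFn_toLp
    have hq1 : Measure.QuasiMeasurePreserving (Prod.fst : Plane × Plane → Plane) :=
      Measure.quasiMeasurePreserving_fst
    have hq2 : Measure.QuasiMeasurePreserving (Prod.snd : Plane × Plane → Plane) :=
      Measure.quasiMeasurePreserving_snd
    have h1 : ∫ p : Plane × Plane, h (sumMap φ p) • (f p.1 * f p.2) =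
        ∫ p : Plane × Plane, ((f₀ p.1 ^ 2 * f₀ p.2 ^ 2 : ℝ) : ℂ) := by
      refine integral_congr_ae ?_
      filter_upwards [hq1.ae hae, hq2.ae hae] with p hp1 hp2
      rw [hp1, hp2]
      by_cases hx : p.1 ∈ B
      · by_cases hy : p.2 ∈ B
        · have := hhval p.1 hx p.2 hy
          rw [show h (sumMap φ p) = f₀ p.1 * f₀ p.2 from this]
          simp only [Complex.real_smul]
          push_cast
          ring
        · simp [hf₀, hy]
      · simp [hf₀, hx]
    rw [h1, integral_complex_ofReal, Measure.volume_eq_prod,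
      integral_prod_mul (fun u => f₀ u ^ 2) (fun u => f₀ u ^ 2), pow_two]
  have hconv : ENNReal.ofReal (A ^ 2 / √K) ≤ convNorm φ f := by
    have h1 := enorm_integral_div_le_convNorm hcont f hhc hhs hhn
    rw [hint] at h1
    rw [ENNReal.ofReal_div_of_pos (by positivity)]
    convert h1 using 2
    rw [← ofReal_norm, Complex.norm_real, Real.norm_of_nonneg (by positivity)]
  refine le_trans (ENNReal.ofReal_le_ofReal ?_) (bestConst_pow_four_ge hA0 hK0 hfnorm hconv)
  have h1 : (Real.pi / (2 * lam * (1 + η)) * (1 - η)) ^ 2 ≤ A ^ 2 := by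
    have := Real.pi_pos
    have : 0 < 1 - η := by linarith
    gcongr
  have h2 : 2 * lam * δ = η := by
    rw [hδdef]; field_simp
  rw [le_div_iff₀ hK0]
  refine le_trans (le_of_eq ?_) h1
  rw [hK, h2, Real.exp_neg]
  have := Real.exp_pos η
  field_simp

theorem pi_div_two_le_bestConst_pow_four (hφ : ContDiff ℝ 2 φ) (hc : ConvexOn ℝ univ φ)
    {y₀ : Plane} (h0 : fderiv ℝ (fderiv ℝ φ) y₀ = 0) :
    ENNReal.ofReal (Real.pi / 2) ≤ bestConst φ ^ 4 := by
  have hlim : Tendsto (fun η : ℝ =>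
      ENNReal.ofReal (Real.pi / 2 * (Real.exp (-η) * ((1 - η) / (1 + η)) ^ 2))) (𝓝[>] 0)
      (𝓝 (ENNReal.ofReal (Real.pi / 2))) := by
    have hcts : ContinuousAt (fun η : ℝ =>
        Real.pi / 2 * (Real.exp (-η) * ((1 - η) / (1 + η)) ^ 2)) 0 := by
      have : ContinuousAt (fun η : ℝ => (1 - η) / (1 + η)) 0 :=
        ContinuousAt.div (by fun_prop) (by fun_prop) (by norm_num)
      fun_prop
    have h1 := ENNReal.tendsto_ofReal (hcts.tendsto.mono_left (nhdsWithin_le_nhds (s := Ioi 0)))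
    simpa using h1
  refine le_of_tendsto hlim ?_
  filter_upwards [Ioo_mem_nhdsGT (zero_lt_one' ℝ)] with η hη
  exact bestConst_pow_four_ge_of_hessian_zero hφ hc h0 hη.1 hη.2

end

/-! ### Lower bounds for the gap -/

section

variable {φ : Plane → ℝ}

lemma plane_eq_sum (v : Plane) :
    v = v 0 • EuclideanSpace.single 0 (1 : ℝ) + v 1 • EuclideanSpace.single 1 (1 : ℝ) := by
  ext i
  fin_cases i <;> simp

lemma fderiv_fderiv_apply_self (φ : Plane → ℝ) (y v : Plane) :
    fderiv ℝ (fderiv ℝ φ) y v v = hessian φ y 0 0 * v 0 ^ 2 +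
      (hessian φ y 0 1 + hessian φ y 1 0) * (v 0 * v 1) + hessian φ y 1 1 * v 1 ^ 2 := by
  conv_lhs => rw [plane_eq_sum v]
  simp only [map_add, map_smul, add_apply, smul_apply, smul_eq_mul, hessian, Matrix.of_apply]
  ring

lemma fderiv_fderiv_eq_zero_of_hessian {y : Plane} (h : hessian φ y = 0) :
    fderiv ℝ (fderiv ℝ φ) y = 0 := by
  have h1 : ∀ i j, fderiv ℝ (fderiv ℝ φ) y (EuclideanSpace.single i 1)
      (EuclideanSpace.single j 1) = 0 := fun i j => congrFun (congrFun h i) j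
  ext v w
  rw [plane_eq_sum v, plane_eq_sum w]
  simp [h1]

lemma plane_norm_sq (v : Plane) : ‖v‖ ^ 2 = v 0 ^ 2 + v 1 ^ 2 := by
  simp [EuclideanSpace.norm_sq_eq]

lemma le_fderiv_fderiv_of_posSemidef {y : Plane} {c : ℝ}
    (h : (hessian φ y - c • (1 : Matrix (Fin 2) (Fin 2) ℝ)).PosSemidef) (v : Plane) :
    c * ‖v‖ ^ 2 ≤ fderiv ℝ (fderiv ℝ φ) y v v := by
  have h1 := h.dotProduct_mulVec_nonneg (fun i => v i)
  simp [Matrix.mulVec, dotProduct, Fin.sum_univ_two, Matrix.one_apply] at h1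
  rw [fderiv_fderiv_apply_self, plane_norm_sq]
  nlinarith

lemma hasDerivAt_fderiv_segment (hφ : ContDiff ℝ 2 φ) (y v : Plane) (t : ℝ) :
    HasDerivAt (fun s : ℝ => fderiv ℝ φ (y + s • v) v)
      (fderiv ℝ (fderiv ℝ φ) (y + t • v) v v) t := by
  have h1 : ContDiff ℝ 1 (fderiv ℝ φ) := hφ.fderiv_right (by norm_num)
  have h2 : HasDerivAt (fun s : ℝ => y + s • v) v t := by
    simpa using ((hasDerivAt_id t).smul_const v).const_add y
  have h3 := (h1.differentiable one_ne_zero (y + t • v)).hasFDerivAt.comp_hasDerivAt t h2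
  have h4 := HasDerivAt.clm_apply h3 (hasDerivAt_const t v)
  simpa using h4

/-- The weak tangent inequality at the midpoint combines with strict convexity there. -/
lemma fderiv_lt_sub (hφ : ContDiff ℝ 1 φ) (hc : StrictConvexOn ℝ univ φ) {x y : Plane}
    (hxy : x ≠ y) : fderiv ℝ φ y (x - y) < φ x - φ y := by
  have h1 := hc.2 (mem_univ x) (mem_univ y) hxy (by norm_num : (0 : ℝ) < 1 / 2)
    (by norm_num : (0 : ℝ) < 1 / 2) (by norm_num)
  have h2 := fderiv_le_sub hφ hc.convexOn ((1 / 2 : ℝ) • x + (1 / 2 : ℝ) • y) y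
  have h3 : ((1 / 2 : ℝ) • x + (1 / 2 : ℝ) • y) - y = (1 / 2 : ℝ) • (x - y) := by module
  rw [h3, map_smul] at h2
  simp only [smul_eq_mul] at h1 h2
  linarith

lemma gap_pos (hφ : ContDiff ℝ 1 φ) (hc : StrictConvexOn ℝ univ φ) {x y : Plane}
    (hxy : x ≠ y) : 0 < gap φ x y := by
  rw [gap_of_ne hxy]
  have hn : 0 < ‖x - y‖ := norm_pos_iff.2 (sub_ne_zero.2 hxy)
  refine div_pos ?_ (by positivity)
  have h1 := fderiv_lt_sub hφ hc hxy
  have h2 := fderiv_lt_sub hφ hc hxy.symm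
  have h3 : fderiv ℝ φ x (y - x) = - fderiv ℝ φ x (x - y) := by
    rw [← map_neg, neg_sub]
  linarith

lemma gap_comm (x y : Plane) : gap φ x y = gap φ y x := by
  by_cases h : x = y
  · rw [h]
  · rw [gap_of_ne h, gap_of_ne (Ne.symm h), ← neg_sub x y, norm_neg, map_neg, map_neg]
    ring

lemma exists_le_gap_of_bounded (hφ : ContDiff ℝ 1 φ) (hc : StrictConvexOn ℝ univ φ) (R : ℝ)
    {ρ : ℝ} (hρ : 0 < ρ) :
    ∃ δ > 0, ∀ x y, ‖x‖ ≤ R → ‖y‖ ≤ R → ρ ≤ ‖x - y‖ → δ ≤ gap φ x y := by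
  set K : Set (Plane × Plane) := (Metric.closedBall 0 R ×ˢ Metric.closedBall 0 R) ∩
    {p | ρ ≤ ‖p.1 - p.2‖} with hK
  have hKc : IsCompact K :=
    ((isCompact_closedBall 0 R).prod (isCompact_closedBall 0 R)).inter_right
      (isClosed_le (by fun_prop) (by fun_prop))
  have hne : ∀ p ∈ K, p.1 ≠ p.2 := by
    rintro p ⟨-, hp⟩ h
    simp only [mem_ofPred_eq, h, sub_self, norm_zero] at hp
    linarith
  have hcont : ContinuousOn (fun p : Plane × Plane => gap φ p.1 p.2) K := by
    have h := hφ.continuous_fderiv one_ne_zero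
    have h1 : ContinuousOn (fun p : Plane × Plane =>
        (fderiv ℝ φ p.1 (p.1 - p.2) - fderiv ℝ φ p.2 (p.1 - p.2)) / (2 * ‖p.1 - p.2‖ ^ 2)) K := by
      refine ContinuousOn.div (by fun_prop) (by fun_prop) fun p hp => ?_
      have := norm_ne_zero_iff.2 (sub_ne_zero.2 (hne p hp))
      positivity
    exact h1.congr fun p hp => gap_of_ne (hne p hp)
  have hmem : ∀ x y : Plane, ‖x‖ ≤ R → ‖y‖ ≤ R → ρ ≤ ‖x - y‖ → (x, y) ∈ K := by
    intro x y hx hy hxy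
    exact ⟨⟨by simpa using hx, by simpa using hy⟩, hxy⟩
  rcases K.eq_empty_or_nonempty with hemp | hnon
  · refine ⟨1, one_pos, fun x y hx hy hxy => ?_⟩
    have := hmem x y hx hy hxy
    simp [hemp] at this
  · obtain ⟨p, hp, hmin⟩ := hKc.exists_isMinOn hnon hcont
    exact ⟨gap φ p.1 p.2, gap_pos hφ hc (hne p hp), fun x y hx hy hxy =>
      hmin (hmem x y hx hy hxy)⟩

/-- The last quarter of the segment from y to x stays within ‖x - y‖/4 ≤ ‖x‖/2 of x, hence outside
the ball of radius r. It alone contributes θ‖x - y‖²/4 to the derivative increment; the rest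
contributes a nonnegative amount. -/
lemma le_gap_of_norm_le (hφ : ContDiff ℝ 2 φ) {r θ : ℝ}
    (h0 : ∀ y v, 0 ≤ fderiv ℝ (fderiv ℝ φ) y v v)
    (hθ : ∀ y, r < ‖y‖ → ∀ v, θ * ‖v‖ ^ 2 ≤ fderiv ℝ (fderiv ℝ φ) y v v) {x y : Plane}
    (hx : 2 * r ≤ ‖x‖) (hyx : ‖y‖ ≤ ‖x‖) (hxy : x ≠ y) : θ / 8 ≤ gap φ x y := by
  have hn : 0 < ‖x - y‖ := norm_pos_iff.2 (sub_ne_zero.2 hxy)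
  set v := x - y with hv
  set g : ℝ → ℝ := fun s => fderiv ℝ φ (y + s • v) v with hg
  have hd : ∀ t, HasDerivAt g (fderiv ℝ (fderiv ℝ φ) (y + t • v) v v) t :=
    hasDerivAt_fderiv_segment hφ y v
  have hdiff : Differentiable ℝ g := fun t => (hd t).differentiableAt
  have h1 : g 0 ≤ g (3 / 4) := by
    refine monotone_of_deriv_nonneg hdiff (fun t => ?_) (by norm_num)
    rw [(hd t).deriv]
    exact h0 _ _
  have h2 : θ * ‖v‖ ^ 2 * (1 - 3 / 4) ≤ g 1 - g (3 / 4) := by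
    refine (convex_Icc (3 / 4 : ℝ) 1).mul_sub_le_image_sub_of_le_deriv
      hdiff.continuous.continuousOn hdiff.differentiableOn (fun t ht => ?_) _
      (by norm_num) _ (by norm_num) (by norm_num)
    rw [interior_Icc] at ht
    rw [(hd t).deriv]
    refine hθ _ ?_ v
    have h3 : y + t • v = x - (1 - t) • v := by rw [hv]; module
    have h4 : ‖v‖ ≤ 2 * ‖x‖ := by
      rw [hv]
      linarith [norm_sub_le x y]
    have h5 := norm_sub_norm_le x ((1 - t) • v)
    rw [norm_smul, Real.norm_of_nonneg (by linarith [ht.2])] at h5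
    rw [h3]
    have : (1 - t) * ‖v‖ < 1 / 4 * ‖v‖ := by
      have := ht.1
      gcongr
      linarith
    linarith
  have e1 : g 1 = fderiv ℝ φ x v := by simp [hg, hv]
  have e0 : g 0 = fderiv ℝ φ y v := by simp [hg]
  rw [gap_of_ne hxy, le_div_iff₀ (by positivity), ← hv, ← e1, ← e0]
  nlinarith

lemma le_gap_of_le_norm (hφ : ContDiff ℝ 2 φ) {r θ : ℝ}
    (h0 : ∀ y v, 0 ≤ fderiv ℝ (fderiv ℝ φ) y v v)
    (hθ : ∀ y, r < ‖y‖ → ∀ v, θ * ‖v‖ ^ 2 ≤ fderiv ℝ (fderiv ℝ φ) y v v) {x y : Plane}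
    (hx : 2 * r ≤ ‖x‖ ∨ 2 * r ≤ ‖y‖) : min (θ / 8) 1 ≤ gap φ x y := by
  by_cases hxy : x = y
  -- The 1 in the minimum accounts for the value of `gap` on the diagonal.
  · simp [gap, hxy]
  · refine (min_le_left _ _).trans ?_
    rcases le_total ‖y‖ ‖x‖ with h | h
    · exact le_gap_of_norm_le hφ h0 hθ (hx.elim id fun h' => h'.trans h) h hxy
    · rw [gap_comm]
      exact le_gap_of_norm_le hφ h0 hθ (hx.elim (fun h' => h'.trans h) id) h (Ne.symm hxy)

lemma exists_ball_norm_sub_lt {G : Type*} [SeminormedAddCommGroup G] {F : Plane → G}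
    (hF : Continuous F) (y₀ : Plane) {η : ℝ} (hη : 0 < η) :
    ∃ ρ > 0, ∀ z ∈ Metric.ball y₀ ρ, ‖F z - F y₀‖ < η := by
  obtain ⟨ρ, hρ, hball⟩ := Metric.continuousAt_iff.1 (hF.continuousAt (x := y₀)) η hη
  exact ⟨ρ, hρ, fun z hz => by simpa [dist_eq_norm] using hball hz⟩

/-- By the mean value theorem the gap is half the normalised second derivative at some point of the
segment, which is within η of its value at y₀. -/
lemma exists_le_gap_near (hφ : ContDiff ℝ 2 φ) (y₀ : Plane) {η : ℝ} (hη : 0 < η) :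
    ∃ ρ > 0, ∀ x y, ‖x - y₀‖ < ρ → ‖y - y₀‖ < ρ → x ≠ y →
      (fderiv ℝ (fderiv ℝ φ) y₀ (x - y) (x - y) / ‖x - y‖ ^ 2 - η) / 2 ≤ gap φ x y := by
  have h1 : ContDiff ℝ 1 (fderiv ℝ φ) := hφ.fderiv_right (by norm_num)
  have h2 : Continuous (fderiv ℝ (fderiv ℝ φ)) := h1.continuous_fderiv one_ne_zero
  obtain ⟨ρ, hρ, hball⟩ := exists_ball_norm_sub_lt
    (G := Plane →L[ℝ] Plane →L[ℝ] ℝ) h2 y₀ hη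
  refine ⟨ρ, hρ, fun x y hx hy hxy => ?_⟩
  have hn : 0 < ‖x - y‖ := norm_pos_iff.2 (sub_ne_zero.2 hxy)
  set v := x - y with hv
  have hd := hasDerivAt_fderiv_segment hφ y v
  obtain ⟨t, ht, hslope⟩ := exists_hasDerivAt_eq_slope _ _ (zero_lt_one' ℝ)
    (fun t _ => (hd t).continuousAt.continuousWithinAt) (fun t _ => hd t)
  have hmem : y + t • v ∈ Metric.ball y₀ ρ := by
    have := (convex_ball y₀ ρ).add_smul_sub_mem (x := y) (y := x)
      (by simpa [dist_eq_norm] using hy) (by simpa [dist_eq_norm] using hx) (Ioo_subset_Icc_self ht)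
    simpa [hv] using this
  have h3 := (hball _ hmem).le
  have h4 : |(fderiv ℝ (fderiv ℝ φ) (y + t • v) - fderiv ℝ (fderiv ℝ φ) y₀) v v| ≤
      η * ‖v‖ * ‖v‖ := by
    refine ((fderiv ℝ (fderiv ℝ φ) (y + t • v) -
      fderiv ℝ (fderiv ℝ φ) y₀).le_opNorm₂ v v).trans ?_
    gcongr
  rw [sub_apply, sub_apply] at h4
  have h5 := (abs_le.1 h4).1
  have e1 : y + (1 : ℝ) • v = x := by simp [hv]
  rw [e1, zero_smul, add_zero, sub_zero, div_one] at hslope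
  rw [gap_of_ne hxy, ← hslope, div_sub' (by positivity), div_div,
    mul_comm (‖v‖ ^ 2) 2]
  gcongr
  linarith

end

/-! ### Angular weights -/

lemma isAngularWeight_one : IsAngularWeight fun _ => 1 where
  measurable := measurable_const
  half_le _ := by norm_num
  homog _ _ _ := rfl
  mean := by
    simp [two_mul]

/-- The angular weight adapted to a quadratic form `Q` with trace `τ`. -/
noncomputable def quadWeight (Q : Plane → ℝ) (τ : ℝ) (v : Plane) : ℝ :=
  1 - (1 + τ / 2)⁻¹ * ((Q v / ‖v‖ ^ 2 - τ / 2) / 2)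

section

variable {Q : Plane → ℝ} {a b c : ℝ}

lemma quadWeight_bounds {τ q : ℝ} (hq : 0 ≤ q) (hq1 : q ≤ τ) :
    1 / 2 ≤ 1 - (1 + τ / 2)⁻¹ * ((q - τ / 2) / 2) ∧
      1 - (1 + τ / 2)⁻¹ * ((q - τ / 2) / 2) ≤ 3 / 2 := by
  have h1 : 0 < 1 + τ / 2 := by linarith
  rw [inv_mul_eq_div]
  have h2 : (q - τ / 2) / 2 / (1 + τ / 2) ≤ 1 / 2 := by
    rw [div_le_iff₀ h1]; linarith
  have h3 : -(1 / 2) ≤ (q - τ / 2) / 2 / (1 + τ / 2) := by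
    rw [le_div_iff₀ h1]; linarith
  constructor <;> linarith

/-- The left side is the value of the product at q = 0. The difference of the two sides is q/2 ·
(3τ/4 - q/2)/(1 + τ/2), nonnegative on [0, τ]; so even flat directions gain. -/
lemma quadWeight_gain {τ q : ℝ} (hq : 0 ≤ q) (hq1 : q ≤ τ) :
    1 + τ / (4 + 2 * τ) ≤ (1 + q / 2) * (1 - (1 + τ / 2)⁻¹ * ((q - τ / 2) / 2)) := by
  have h1 : 0 < 1 + τ / 2 := by linarith
  have h2 : 4 + 2 * τ = 4 * (1 + τ / 2) := by ring
  have hne : 2 + τ ≠ 0 := fun h => by linarith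
  have h3 : (1 + q / 2) * (1 - (1 + τ / 2)⁻¹ * ((q - τ / 2) / 2)) - (1 + τ / (4 + 2 * τ)) =
      q / 2 * (3 * τ / 4 - q / 2) / (1 + τ / 2) := by
    rw [h2]
    field_simp
    ring
  have h4 : 0 ≤ q / 2 * (3 * τ / 4 - q / 2) / (1 + τ / 2) := by
    apply div_nonneg (mul_nonneg (by positivity) (by linarith)) h1.le
  linarith

/-- The values of Q at v and at v rotated by a right angle add up to (a + c)‖v‖², and both are
nonnegative. -/
lemma quad_le_trace (hQ : ∀ v, Q v = a * v 0 ^ 2 + b * (v 0 * v 1) + c * v 1 ^ 2)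
    (hQ0 : ∀ v, 0 ≤ Q v) (v : Plane) : Q v / ‖v‖ ^ 2 ≤ a + c := by
  have h1 := hQ0 !₂[-v 1, v 0]
  have h2 : 0 ≤ a + c := by
    have h3 := hQ0 !₂[1, 0]
    have h4 := hQ0 !₂[0, 1]
    rw [hQ] at h3 h4
    simp at h3 h4
    linarith
  refine div_le_of_le_mul₀ (by positivity) h2 ?_
  rw [hQ] at h1 ⊢
  simp at h1
  rw [plane_norm_sq]
  nlinarith

/-- The mean is one because a quadratic form averages to half its trace over the unit circle. -/
lemma isAngularWeight_quadWeight
    (hQ : ∀ v, Q v = a * v 0 ^ 2 + b * (v 0 * v 1) + c * v 1 ^ 2)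
    (hQ0 : ∀ v, 0 ≤ Q v) : IsAngularWeight (quadWeight Q (a + c)) where
  measurable := by
    have h1 : Measurable Q := by
      rw [funext hQ]
      fun_prop
    unfold quadWeight
    fun_prop
  half_le v := (quadWeight_bounds (div_nonneg (hQ0 v) (by positivity))
    (quad_le_trace hQ hQ0 v)).1
  homog r hr v := by
    have h1 : Q (r • v) = r ^ 2 * Q v := by
      rw [hQ, hQ]
      simp only [PiLp.smul_apply, smul_eq_mul]
      ring
    unfold quadWeight
    rw [h1, norm_smul, mul_pow, Real.norm_eq_abs, sq_abs, mul_div_mul_left _ _ (by positivity)]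
  mean := by
    have hcont : Continuous fun θ => quadWeight Q (a + c) (dir θ) := by
      have h1 : Continuous Q := by
        rw [funext hQ]
        fun_prop
      have h2 : Continuous fun θ => Q (dir θ) := h1.comp continuous_dir
      simp only [quadWeight, norm_dir]
      exact continuous_const.sub
        (continuous_const.mul (((h2.div_const _).sub continuous_const).div_const _))
    have hint : IntegrableOn (fun θ => quadWeight Q (a + c) (dir θ)) (Ioo (-Real.pi) Real.pi) :=
      (hcont.integrableOn_Icc).mono_set Ioo_subset_Icc_self
    rw [← ofReal_integral_eq_lintegral_ofReal hint (Eventually.of_forall fun θ => by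
      have := (quadWeight_bounds (div_nonneg (hQ0 (dir θ)) (by positivity))
        (quad_le_trace hQ hQ0 (dir θ))).1
      simp only [quadWeight, Pi.zero_apply]
      linarith)]
    congr 1
    rw [← integral_Ioc_eq_integral_Ioo, ← intervalIntegral.integral_of_le
      (by linarith [Real.pi_pos])]
    have h1 : ∀ θ, quadWeight Q (a + c) (dir θ) = (1 + (1 + (a + c) / 2)⁻¹ * ((a + c) / 4)) -
        ((1 + (a + c) / 2)⁻¹ / 2 * a * Real.cos θ ^ 2 +
          (1 + (a + c) / 2)⁻¹ / 2 * b * (Real.sin θ * Real.cos θ) +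
          (1 + (a + c) / 2)⁻¹ / 2 * c * Real.sin θ ^ 2) := fun θ => by
      simp only [quadWeight, norm_dir, hQ]
      simp only [dir, PiLp.toLp_apply, Matrix.cons_val_zero, Matrix.cons_val_one]
      ring
    have h2 : ∀ A B C : ℝ, ∫ θ in (-Real.pi)..Real.pi,
        (A * Real.cos θ ^ 2 + B * (Real.sin θ * Real.cos θ) + C * Real.sin θ ^ 2) =
        Real.pi * (A + C) := fun A B C => by
      rw [intervalIntegral.integral_add (by apply Continuous.intervalIntegrable; fun_prop)
          (by apply Continuous.intervalIntegrable; fun_prop),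
        intervalIntegral.integral_add (by apply Continuous.intervalIntegrable; fun_prop)
          (by apply Continuous.intervalIntegrable; fun_prop)]
      simp only [intervalIntegral.integral_const_mul, integral_cos_sq, integral_sin_sq,
        integral_sin_mul_cos₁]
      simp
      ring
    simp only [h1]
    rw [intervalIntegral.integral_sub (by simp)
      (by apply Continuous.intervalIntegrable; fun_prop), h2, intervalIntegral.integral_const,
      smul_eq_mul]
    ring

end

/-! ### Concentration of extremizing sequences -/

section

variable {φ : Plane → ℝ} {f : ℕ → L2Plane}

lemma integral_eq_massMeasure (g : L2Plane) {s : Set Plane} (hs : MeasurableSet s) :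
    ∫ x in s, ‖g x‖ ^ 2 = (massMeasure g).real s := by
  rw [Measure.real, massMeasure, withDensity_apply _ hs, integral_eq_lintegral_of_nonneg_ae
    (Eventually.of_forall fun x => by positivity)
    (StronglyMeasurable.aestronglyMeasurable (by
      have := (Lp.stronglyMeasurable g).norm
      fun_prop))]
  congr 1
  refine lintegral_congr fun x => ?_
  rw [ENNReal.ofReal_pow (norm_nonneg _), ofReal_norm]

lemma massMeasure_real_univ (g : L2Plane) : (massMeasure g).real univ = ‖g‖ ^ 2 := by
  rw [Measure.real, massMeasure_univ, ENNReal.toReal_pow, toReal_enorm]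

lemma lintegral_inv_weight_le {X : Type*} [MeasurableSpace X] (m : Measure X) [IsFiniteMeasure m]
    {w : X → ℝ} {s : Set X} (hs : MeasurableSet s) {a b : ℝ} (ha : 0 < a) (hb : 0 < b)
    (hwa : ∀ x ∈ s, a ≤ w x) (hwb : ∀ x ∈ sᶜ, b ≤ w x) :
    ∫⁻ x, (ENNReal.ofReal (w x))⁻¹ ∂m ≤ ENNReal.ofReal (m.real s / a + m.real sᶜ / b) := by
  have key : ∀ {t : Set X} {d : ℝ}, MeasurableSet t → 0 < d → (∀ x ∈ t, d ≤ w x) →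
      ∫⁻ x in t, (ENNReal.ofReal (w x))⁻¹ ∂m ≤ ENNReal.ofReal (m.real t / d) := by
    intro t d ht hd h
    calc ∫⁻ x in t, (ENNReal.ofReal (w x))⁻¹ ∂m ≤ ∫⁻ _ in t, (ENNReal.ofReal d)⁻¹ ∂m :=
          setLIntegral_mono' ht fun x hx =>
            ENNReal.inv_le_inv.2 (ENNReal.ofReal_le_ofReal (h x hx))
      _ = ENNReal.ofReal (m.real t / d) := by
          rw [setLIntegral_const, ENNReal.ofReal_div_of_pos hd, ofReal_measureReal, mul_comm,
            div_eq_mul_inv]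
  rw [← lintegral_add_compl _ hs, ENNReal.ofReal_add (by positivity) (by positivity)]
  exact add_le_add (key hs ha hwa) (key hs.compl hb hwb)

/-- Upper and lower bounds share the constant π/2, so along an extremizing sequence the integral of
1/weight eventually exceeds any t < 1; here it is bounded by a two-valued step function. -/
lemma eventually_lt_of_extremizing (hφ : ContDiff ℝ 1 φ) (hc : ConvexOn ℝ univ φ)
    (hbest : ENNReal.ofReal (Real.pi / 2) ≤ bestConst φ ^ 4) (hf : IsExtremizing φ f)
    {β : Plane → ℝ} (hβ : IsAngularWeight β) {t : ℝ} (ht : t < 1) {s : Set (Plane × Plane)}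
    (hs : MeasurableSet s) {a b : ℝ} (ha : 0 < a) (hb : 0 < b)
    (hwa : ∀ x ∈ s, a ≤ weight φ β x) (hwb : ∀ x ∈ sᶜ, b ≤ weight φ β x) :
    ∀ᶠ n in atTop, t < ((massMeasure (f n)).prod (massMeasure (f n))).real s / a +
      ((massMeasure (f n)).prod (massMeasure (f n))).real sᶜ / b := by
  have hpi : ENNReal.ofReal (Real.pi / 2) ≠ 0 := by simp [Real.pi_pos]
  have hlt : ENNReal.ofReal (Real.pi / 2) * ENNReal.ofReal t < bestConst φ ^ 4 := by
    refine lt_of_lt_of_le ?_ hbest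
    conv_rhs => rw [← mul_one (ENNReal.ofReal (Real.pi / 2))]
    exact ENNReal.mul_lt_mul_right hpi ENNReal.ofReal_ne_top
      (by rwa [ENNReal.ofReal_lt_one])
  have hlim : Tendsto (fun n => convNorm φ (f n) ^ 2) atTop (𝓝 (bestConst φ ^ 4)) := by
    have := ENNReal.Tendsto.pow (n := 2) hf.2
    rwa [← pow_mul] at this
  filter_upwards [hlim.eventually_const_lt hlt] with n hn
  have h1 := hn.trans_le (convNorm_sq_le hφ hc hβ (f n))
  have h2 := (ENNReal.mul_lt_mul_iff_right hpi ENNReal.ofReal_ne_top).1 h1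
  have h3 := h2.trans_le (lintegral_inv_weight_le _ hs ha hb hwa hwb)
  exact (ENNReal.ofReal_lt_ofReal_iff'.1 h3).1

lemma measureReal_prod_univ_le_one (hf : IsExtremizing φ f) (n : ℕ) :
    ((massMeasure (f n)).prod (massMeasure (f n))).real univ ≤ 1 := by
  rw [← univ_prod_univ, measureReal_prod_prod, massMeasure_real_univ]
  have := hf.1 n
  have := norm_nonneg (f n)
  have : ‖f n‖ ^ 2 ≤ 1 := by nlinarith
  nlinarith [sq_nonneg ‖f n‖]

lemma eventually_half_le_norm_sq (hφ : ContDiff ℝ 1 φ) (hc : ConvexOn ℝ univ φ)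
    (hbest : ENNReal.ofReal (Real.pi / 2) ≤ bestConst φ ^ 4) (hf : IsExtremizing φ f) :
    ∀ᶠ n in atTop, 1 / 2 ≤ ‖f n‖ ^ 2 := by
  have hw : ∀ x, 1 ≤ weight φ (fun _ => 1) x := fun x => by
    have := gap_nonneg hφ hc x.1 x.2
    simp only [weight]
    linarith
  filter_upwards [eventually_lt_of_extremizing hφ hc hbest hf isAngularWeight_one
    (by norm_num : (1 / 2 : ℝ) < 1) MeasurableSet.univ one_pos one_pos (fun x _ => hw x)
    (fun x _ => hw x)] with n hn
  rw [compl_univ, measureReal_empty, ← univ_prod_univ, measureReal_prod_prod,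
    massMeasure_real_univ] at hn
  have := hf.1 n
  have := norm_nonneg (f n)
  have : ‖f n‖ ^ 2 ≤ 1 := by nlinarith
  nlinarith [sq_nonneg ‖f n‖]

lemma eventually_prod_lt_of_le_gap (hφ : ContDiff ℝ 1 φ) (hc : ConvexOn ℝ univ φ)
    (hbest : ENNReal.ofReal (Real.pi / 2) ≤ bestConst φ ^ 4) (hf : IsExtremizing φ f)
    {s : Set (Plane × Plane)} (hs : MeasurableSet s) {δ : ℝ} (hδ : 0 < δ)
    (hgap : ∀ p ∈ s, δ ≤ gap φ p.1 p.2) {ε : ℝ} (hε : 0 < ε) :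
    ∀ᶠ n in atTop, ((massMeasure (f n)).prod (massMeasure (f n))).real s < ε := by
  have hκ : 0 < δ / (1 + δ) := by positivity
  filter_upwards [eventually_lt_of_extremizing hφ hc hbest hf isAngularWeight_one
    (by nlinarith : 1 - δ / (1 + δ) * ε < 1) hs (by positivity : 0 < 1 + δ) one_pos
    (fun x hx => by
      have := hgap x hx
      simp only [weight]
      linarith)
    (fun x _ => by
      have := gap_nonneg hφ hc x.1 x.2
      simp only [weight]
      linarith)] with n hn
  have h1 := measureReal_prod_univ_le_one hf n
  rw [← measureReal_add_measureReal_compl hs] at h1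
  set m := ((massMeasure (f n)).prod (massMeasure (f n))).real s with hm
  have h2 : m / (1 + δ) = m - δ / (1 + δ) * m := by
    field_simp
    ring
  have h3 : δ / (1 + δ) * m < δ / (1 + δ) * ε := by linarith
  exact lt_of_mul_lt_mul_left h3 hκ.le

/-- On A the gap is bounded below, so the product mass of A is small. By Fubini some section of A
has small mass, and its base point is the required centre. -/
lemma eventually_exists_concentrated (hφ : ContDiff ℝ 1 φ) (hc : StrictConvexOn ℝ univ φ)
    (hbest : ENNReal.ofReal (Real.pi / 2) ≤ bestConst φ ^ 4) (hf : IsExtremizing φ f)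
    {R δ : ℝ} (hδ : 0 < δ) (hfar : ∀ x y, R ≤ ‖x‖ ∨ R ≤ ‖y‖ → δ ≤ gap φ x y)
    {ε ρ : ℝ} (hε : 0 < ε) (hρ : 0 < ρ) :
    ∀ᶠ n in atTop, ∃ y : Plane, ‖y‖ ≤ R ∧
      (massMeasure (f n)).real {x | ρ ≤ ‖x - y‖} ≤ ε := by
  obtain ⟨δ', hδ', hnear⟩ := exists_le_gap_of_bounded hφ hc R hρ
  set A : Set (Plane × Plane) := {p | R ≤ ‖p.1‖} ∪ {p | ρ ≤ ‖p.2 - p.1‖} with hA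
  have hAm : MeasurableSet A :=
    (measurableSet_le (by fun_prop) (by fun_prop)).union
      (measurableSet_le (by fun_prop) (by fun_prop))
  have hgap : ∀ p ∈ A, min δ δ' ≤ gap φ p.1 p.2 := by
    intro p hp
    by_cases h : R ≤ ‖p.1‖ ∨ R ≤ ‖p.2‖
    · exact (min_le_left _ _).trans (hfar _ _ h)
    · push Not at h
      refine (min_le_right _ _).trans (hnear _ _ h.1.le h.2.le ?_)
      rcases hp with hp | hp
      · exact absurd hp (not_le.2 h.1)
      · rw [norm_sub_rev]
        exact hp
  have hε' : 0 < min ε (1 / 2) := lt_min hε (by norm_num)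
  filter_upwards [eventually_prod_lt_of_le_gap hφ hc.convexOn hbest hf hAm (lt_min hδ hδ') hgap
    (half_pos hε'), eventually_half_le_norm_sq hφ hc.convexOn hbest hf] with n hn hmass
  by_contra! hcon
  set μ := massMeasure (f n) with hμ
  have hsec : ∀ y, ENNReal.ofReal (min ε (1 / 2)) ≤ μ (Prod.mk y ⁻¹' A) := by
    intro y
    rw [← ofReal_measureReal]
    refine ENNReal.ofReal_le_ofReal ?_
    by_cases hy : R ≤ ‖y‖
    -- Sections over far base points carry the full mass, at least 1/2, so only a near base point
    -- could give a small one.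
    · have : Prod.mk y ⁻¹' A = univ := eq_univ_of_forall fun x => Or.inl hy
      rw [this, massMeasure_real_univ]
      exact (min_le_right _ _).trans hmass
    · refine (min_le_left _ _).trans ((hcon y (not_le.1 hy).le).le.trans ?_)
      exact measureReal_mono fun x hx => Or.inr hx
  have h1 : ENNReal.ofReal (min ε (1 / 2)) * μ univ ≤ μ.prod μ A := by
    rw [Measure.prod_apply hAm, ← lintegral_const]
    exact lintegral_mono hsec
  rw [← ofReal_measureReal, ← ofReal_measureReal, ← ENNReal.ofReal_mul hε'.le,
    ENNReal.ofReal_le_ofReal_iff measureReal_nonneg, massMeasure_real_univ] at h1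
  nlinarith

lemma exists_subseq_concentratesAt (hφ : ContDiff ℝ 1 φ) (hc : StrictConvexOn ℝ univ φ)
    (hbest : ENNReal.ofReal (Real.pi / 2) ≤ bestConst φ ^ 4) (hf : IsExtremizing φ f)
    {R δ : ℝ} (hδ : 0 < δ) (hfar : ∀ x y, R ≤ ‖x‖ ∨ R ≤ ‖y‖ → δ ≤ gap φ x y) :
    ∃ (y₀ : Plane) (l : ℕ → ℕ), StrictMono l ∧ ConcentratesAt (fun n => f (l n)) y₀ := by
  have hev : ∀ j : ℕ, ∀ᶠ n in atTop, 1 / 2 ≤ ‖f n‖ ^ 2 ∧ ∃ y : Plane, ‖y‖ ≤ R ∧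
      (massMeasure (f n)).real {x | (1 : ℝ) / (j + 1) ≤ ‖x - y‖} ≤ 1 / (j + 1) := fun j =>
    (eventually_half_le_norm_sq hφ hc.convexOn hbest hf).and
      (eventually_exists_concentrated hφ hc hbest hf hδ hfar (by positivity) (by positivity))
  obtain ⟨l, hl, hP⟩ := extraction_forall_of_eventually hev
  choose hmass y hyR hy using hP
  obtain ⟨y₀, -, k, hk, hlim⟩ := (isCompact_closedBall (0 : Plane) R).tendsto_subseq
    (x := y) (fun n => by simpa using hyR n)
  refine ⟨y₀, l ∘ k, hl.comp hk, fun ε hε ρ hρ => ?_⟩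
  have h1 : ∀ᶠ j in atTop, ‖y (k j) - y₀‖ < ρ / 2 := by
    have := (Metric.tendsto_nhds.1 hlim) (ρ / 2) (half_pos hρ)
    simpa [dist_eq_norm] using this
  have h2 : Tendsto (fun j : ℕ => (1 : ℝ) / ((k j : ℝ) + 1)) atTop (𝓝 0) :=
    tendsto_one_div_add_atTop_nhds_zero_nat.comp hk.tendsto_atTop
  obtain ⟨N, hN⟩ := eventually_atTop.1 (h1.and ((h2.eventually_lt_const (half_pos hρ)).and
    (h2.eventually_lt_const (half_pos hε))))
  refine ⟨N, fun n hn => ?_⟩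
  obtain ⟨h3, h4, h5⟩ := hN n hn
  rw [integral_eq_massMeasure _ (measurableSet_le (by fun_prop) (by fun_prop))]
  calc (massMeasure (f (l (k n)))).real {x | ρ ≤ ‖x - y₀‖}
      ≤ (massMeasure (f (l (k n)))).real {x | (1 : ℝ) / ((k n : ℝ) + 1) ≤ ‖x - y (k n)‖} := by
        refine measureReal_mono fun x hx => ?_
        have hx : ρ ≤ ‖x - y₀‖ := hx
        have := norm_sub_le_norm_sub_add_norm_sub x (y (k n)) y₀
        simp only [mem_ofPred_eq]
        linarith
    _ ≤ 1 / ((k n : ℝ) + 1) := hy (k n)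
    -- The bound ‖f‖² ≥ 1/2 turns the absolute mass bound ε/2 into a relative one.
    _ ≤ ε * ‖f (l (k n))‖ ^ 2 := by nlinarith [hmass (k n)]

/-- If the Hessian is nonzero its trace is positive. With the adapted `quadWeight` the total weight
then exceeds 1 uniformly near (y₀, y₀), where nearly all the product mass sits, contradicting
extremality. -/
lemma hessian_eq_zero_of_concentratesAt (hφ : ContDiff ℝ 2 φ) (hc : ConvexOn ℝ univ φ)
    (hbest : ENNReal.ofReal (Real.pi / 2) ≤ bestConst φ ^ 4) (hf : IsExtremizing φ f)
    {y₀ : Plane} (hpsd : (hessian φ y₀).PosSemidef) (hconc : ConcentratesAt f y₀) :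
    hessian φ y₀ = 0 := by
  by_contra hne
  have hφ1 : ContDiff ℝ 1 φ := hφ.of_le (by norm_num)
  set Q : Plane → ℝ := fun v => fderiv ℝ (fderiv ℝ φ) y₀ v v with hQdef
  have hQ := fderiv_fderiv_apply_self φ y₀
  have hQ0 : ∀ v, 0 ≤ Q v := fun v => by
    have := le_fderiv_fderiv_of_posSemidef (φ := φ) (y := y₀) (c := 0) (by simpa using hpsd) v
    simpa using this
  set τ := hessian φ y₀ 0 0 + hessian φ y₀ 1 1 with hτ
  have hτ0 : 0 < τ := by
    have h1 : 0 ≤ τ := add_nonneg hpsd.diag_nonneg hpsd.diag_nonneg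
    refine lt_of_le_of_ne h1 fun h => hne (hpsd.trace_eq_zero_iff.1 ?_)
    rw [Matrix.trace_fin_two]
    exact h.symm
  have hβ : IsAngularWeight (quadWeight Q τ) := isAngularWeight_quadWeight hQ hQ0
  set κ := τ / (4 + 2 * τ) with hκ
  have hκ0 : 0 < κ := by positivity
  have hκ1 : κ ≤ 1 / 2 := by
    rw [hκ, div_le_iff₀ (by positivity)]
    linarith
  -- The error in the gap is κ/3; multiplied by the upper bound 3/2 of the angular weight it costs
  -- κ/2, half of the gain κ.
  obtain ⟨ρ, hρ, hgap⟩ := exists_le_gap_near hφ y₀ (η := 2 * κ / 3) (by positivity)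
  set B := {x : Plane | ρ ≤ ‖x - y₀‖}ᶜ with hB
  have hBm : MeasurableSet B := (measurableSet_le (by fun_prop) (by fun_prop)).compl
  have hBmem : ∀ x ∈ B, ‖x - y₀‖ < ρ := fun x hx => not_le.1 hx
  have hw : ∀ p ∈ B ×ˢ B, 1 + κ / 2 ≤ weight φ (quadWeight Q τ) p := by
    rintro ⟨x, y⟩ ⟨hx, hy⟩
    have hq0 : 0 ≤ Q (x - y) / ‖x - y‖ ^ 2 := div_nonneg (hQ0 _) (by positivity)
    have hq1 : Q (x - y) / ‖x - y‖ ^ 2 ≤ τ := quad_le_trace hQ hQ0 _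
    have h1 := quadWeight_bounds hq0 hq1
    have h2 := quadWeight_gain hq0 hq1
    by_cases hxy : x = y
    · have h3 : Q 0 / ‖(0 : Plane)‖ ^ 2 = 0 := by simp
      have h4 : 0 ≤ (1 + τ / 2)⁻¹ := by positivity
      simp only [weight, gap, hxy, if_true, sub_self, quadWeight, h3]
      nlinarith
    · have h3 := hgap x y (hBmem x hx) (hBmem y hy) hxy
      simp only [weight]
      have e : quadWeight Q τ (x - y) =
        1 - (1 + τ / 2)⁻¹ * ((Q (x - y) / ‖x - y‖ ^ 2 - τ / 2) / 2) := rfl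
      rw [← e] at h1 h2
      set b := quadWeight Q τ (x - y)
      have h4 : (1 + Q (x - y) / ‖x - y‖ ^ 2 / 2 - κ / 3) * b ≤ (1 + gap φ x y) * b := by
        refine mul_le_mul_of_nonneg_right ?_ (by linarith)
        simp only [hQdef]
        linarith
      nlinarith
  have hwc : ∀ p ∈ (B ×ˢ B)ᶜ, 1 / 2 ≤ weight φ (quadWeight Q τ) p := fun p _ =>
    half_le_weight hφ1 hc hβ p
  -- Budget: the mass near (y₀, y₀) contributes at most 1/(1 + κ/2) ≤ 1 - κ/4. The remaining product
  -- mass is at most 2·κ/32, which the weight bound 1/2 doubles to κ/8.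
  have hlt : 1 - κ / 8 < 1 := by linarith
  obtain ⟨N, hN⟩ := hconc (κ / 32) (by positivity) ρ hρ
  obtain ⟨n, hn, hnN⟩ := ((eventually_lt_of_extremizing hφ1 hc hbest hf hβ hlt (hBm.prod hBm)
    (by positivity : 0 < 1 + κ / 2) (by norm_num : (0 : ℝ) < 1 / 2) hw hwc).and
    (eventually_ge_atTop N)).exists
  have h1 := hN n hnN
  have hn1 := hf.1 n
  have hn0 := norm_nonneg (f n)
  have hnsq : ‖f n‖ ^ 2 ≤ 1 := by nlinarith
  rw [integral_eq_massMeasure _ (measurableSet_le (by fun_prop) (by fun_prop))] at h1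
  have hBc : (massMeasure (f n)).real Bᶜ ≤ κ / 32 := by
    rw [hB, compl_compl]
    nlinarith
  set μ := massMeasure (f n) with hμ
  have huniv : μ.real univ ≤ 1 := by
    rw [massMeasure_real_univ]
    exact hnsq
  have h2 : (μ.prod μ).real (B ×ˢ B)ᶜ ≤ 2 * (κ / 32) := by
    have hsub : (B ×ˢ B)ᶜ ⊆ (Bᶜ ×ˢ univ) ∪ (univ ×ˢ Bᶜ) := by
      rintro ⟨x, y⟩ h
      by_cases hx : x ∈ B
      · exact Or.inr ⟨trivial, fun hy => h ⟨hx, hy⟩⟩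
      · exact Or.inl ⟨hx, trivial⟩
    refine (measureReal_mono hsub).trans ((measureReal_union_le _ _).trans ?_)
    rw [measureReal_prod_prod, measureReal_prod_prod]
    have : 0 ≤ μ.real Bᶜ := measureReal_nonneg
    nlinarith
  have h3 : (μ.prod μ).real (B ×ˢ B) / (1 + κ / 2) ≤ 1 - κ / 4 := by
    have h4 : (μ.prod μ).real (B ×ˢ B) ≤ 1 :=
      (measureReal_mono (subset_univ _)).trans (measureReal_prod_univ_le_one hf n)
    rw [div_le_iff₀ (by positivity)]
    nlinarith
  rw [div_eq_mul_inv _ (1 / 2 : ℝ), show (1 / 2 : ℝ)⁻¹ = 2 by norm_num] at hn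
  linarith

end

lemma IsExtremizing.comp {φ : Plane → ℝ} {f : ℕ → L2Plane} (hf : IsExtremizing φ f) {k : ℕ → ℕ}
    (hk : StrictMono k) : IsExtremizing φ fun n => f (k n) :=
  ⟨fun n => hf.1 (k n), hf.2.comp hk.tendsto_atTop⟩

/-- A sequence each of whose subsequences has a further subsequence concentrating at a point of
`E` concentrates along a sequence in `E`. -/
lemma exists_concentratesAlong {f : ℕ → L2Plane} {E : Set Plane} (hE : E.Nonempty)
    (h : ∀ k : ℕ → ℕ, StrictMono k → ∃ y₀ ∈ E, ∃ l : ℕ → ℕ, StrictMono l ∧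
      ConcentratesAt (fun n => f (k (l n))) y₀) :
    ∃ y : ℕ → Plane, (∀ n, y n ∈ E) ∧ ConcentratesAlong f y := by
  classical
  let P : ℕ → ℕ → Plane → Prop := fun n j e =>
    ∫ x in {x : Plane | (1 : ℝ) / (j + 1) ≤ ‖x - e‖}, ‖f n x‖ ^ 2 ≤ 1 / (j + 1) * ‖f n‖ ^ 2
  have hP : ∀ j, ∀ᶠ n in atTop, ∃ e ∈ E, P n j e := by
    intro j
    by_contra hcon
    obtain ⟨k, hk, hkn⟩ := extraction_of_frequently_atTop (not_eventually.1 hcon)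
    obtain ⟨y₀, hy₀, l, -, hconc⟩ := h k hk
    obtain ⟨N, hN⟩ := hconc (1 / (j + 1)) (by positivity) (1 / (j + 1)) (by positivity)
    exact hkn (l N) ⟨y₀, hy₀, hN N le_rfl⟩
  obtain ⟨e₀, he₀⟩ := hE
  let S : ℕ → ℕ → Prop := fun n j => ∃ e ∈ E, P n j e
  -- Diagonal choice: for each n take the finest scale 1/(j + 1), j ≤ n, at which some point of E
  -- captures `f n`. Every fixed scale is eventually attained, so the chosen scales tend to zero.
  have hchoice : ∀ n, ∃ e ∈ E, (∃ j ≤ n, S n j) → P n (Nat.findGreatest (S n) n) e := by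
    intro n
    by_cases hn : ∃ j ≤ n, S n j
    · obtain ⟨j, hj, hSj⟩ := hn
      obtain ⟨e, he, hPe⟩ := Nat.findGreatest_spec hj hSj
      exact ⟨e, he, fun _ => hPe⟩
    · exact ⟨e₀, he₀, fun h => absurd h hn⟩
  choose y hyE hy using hchoice
  refine ⟨y, hyE, fun ε hε ρ hρ => ?_⟩
  obtain ⟨j, hj⟩ := exists_nat_one_div_lt (lt_min hε hρ)
  obtain ⟨N, hN⟩ := eventually_atTop.1 (hP j)
  refine ⟨max N j, fun n hn => ?_⟩
  have hSj : S n j := hN n (le_of_max_le_left hn)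
  have hjn : j ≤ n := le_of_max_le_right hn
  have h1 := hy n ⟨j, hjn, hSj⟩
  set i := Nat.findGreatest (S n) n with hi
  have hji : j ≤ i := Nat.le_findGreatest hjn hSj
  have h2 : (1 : ℝ) / (i + 1) ≤ 1 / (j + 1) := by gcongr
  have hε2 : (1 : ℝ) / (i + 1) ≤ ε := h2.trans (hj.le.trans (min_le_left _ _))
  have hρ2 : (1 : ℝ) / (i + 1) ≤ ρ := h2.trans (hj.le.trans (min_le_right _ _))
  have h3 : ∫ x in {x : Plane | (1 : ℝ) / (i + 1) ≤ ‖x - y n‖}, ‖f n x‖ ^ 2 ≤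
      1 / (i + 1) * ‖f n‖ ^ 2 := h1
  rw [integral_eq_massMeasure _ (measurableSet_le (by fun_prop) (by fun_prop))] at h3 ⊢
  calc (massMeasure (f n)).real {x | ρ ≤ ‖x - y n‖}
      ≤ (massMeasure (f n)).real {x | (1 : ℝ) / (i + 1) ≤ ‖x - y n‖} :=
        measureReal_mono fun x hx => hρ2.trans hx
    _ ≤ 1 / (i + 1) * ‖f n‖ ^ 2 := h3
    _ ≤ ε * ‖f n‖ ^ 2 := by gcongr

/-- Extremizing sequences have subsequences concentrating at a zero of the Hessian. -/
lemma exists_subseq_concentratesAt_hessian_zero {φ : Plane → ℝ} (hφ : ContDiff ℝ 2 φ)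
    (hc : StrictConvexOn ℝ univ φ) (hE : ∃ y, hessian φ y = 0) {r₀ : ℝ} {Θ : Plane → ℝ}
    (hΘ_nonneg : ∀ y, 0 ≤ Θ y) (hr₀ : 0 ≤ r₀)
    (hΘ_inf : ∀ r > r₀, 0 < ⨅ y : {y : Plane // r < ‖y‖}, Θ y)
    (hΘ : ∀ y, (hessian φ y - Θ y • (1 : Matrix (Fin 2) (Fin 2) ℝ)).PosSemidef)
    {f : ℕ → L2Plane} (hf : IsExtremizing φ f) :
    ∃ y₀, hessian φ y₀ = 0 ∧ ‖y₀‖ ≤ r₀ ∧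
      ∃ l : ℕ → ℕ, StrictMono l ∧ ConcentratesAt (fun n => f (l n)) y₀ := by
  have hφ1 : ContDiff ℝ 1 φ := hφ.of_le (by norm_num)
  obtain ⟨e, he⟩ := hE
  have hbest := pi_div_two_le_bestConst_pow_four hφ hc.convexOn (fderiv_fderiv_eq_zero_of_hessian he)
  have hquad := fun y => le_fderiv_fderiv_of_posSemidef (hΘ y)
  have h0 : ∀ y v, 0 ≤ fderiv ℝ (fderiv ℝ φ) y v v := fun y v =>
    (mul_nonneg (hΘ_nonneg y) (sq_nonneg _)).trans (hquad y v)
  have hinf : ∀ r y, r < ‖y‖ → ⨅ y : {y : Plane // r < ‖y‖}, Θ y ≤ Θ y := fun r y hy =>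
    ciInf_le ⟨0, by rintro _ ⟨z, rfl⟩; exact hΘ_nonneg z⟩ (⟨y, hy⟩ : {y : Plane // r < ‖y‖})
  set θ := ⨅ y : {y : Plane // r₀ + 1 < ‖y‖}, Θ y with hθ
  have hθ0 : 0 < θ := hΘ_inf (r₀ + 1) (by linarith)
  have hfar : ∀ x y, 2 * (r₀ + 1) ≤ ‖x‖ ∨ 2 * (r₀ + 1) ≤ ‖y‖ → min (θ / 8) 1 ≤ gap φ x y :=
    fun x y hxy => le_gap_of_le_norm hφ h0 (fun z hz v =>
      (mul_le_mul_of_nonneg_right (hinf _ z hz) (sq_nonneg _)).trans (hquad z v)) hxy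
  obtain ⟨y₀, l, hl, hconc⟩ := exists_subseq_concentratesAt hφ1 hc hbest hf
    (lt_min (by positivity) one_pos) hfar
  have hpsd : (hessian φ y₀).PosSemidef := by
    have h1 := (hΘ y₀).add (Matrix.PosSemidef.one.smul (hΘ_nonneg y₀))
    simpa using h1
  have hzero := hessian_eq_zero_of_concentratesAt hφ hc.convexOn hbest (hf.comp hl) hpsd hconc
  refine ⟨y₀, hzero, ?_, l, hl, hconc⟩
  -- A radius strictly between r₀ and ‖y₀‖ gives Θ y₀ > 0, which is incompatible with the Hessian
  -- vanishing at y₀, as seen in the direction of y₀ itself.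
  by_contra! hlt
  have h1 := (hΘ_inf ((r₀ + ‖y₀‖) / 2) (by linarith)).trans_le (hinf _ y₀ (by linarith))
  have h2 := hquad y₀ y₀
  rw [fderiv_fderiv_eq_zero_of_hessian hzero] at h2
  simp only [zero_apply] at h2
  have h3 : 0 < ‖y₀‖ := by linarith
  have : 0 < Θ y₀ * ‖y₀‖ ^ 2 := by positivity
  linarith

end PerturbedParaboloid

theorem corollary5p6
    (φ : PerturbedParaboloid.Plane → ℝ)
    (hφ_nonneg : ∀ y, 0 ≤ φ y)
    (hφ_smooth : ContDiff ℝ 2 φ)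
    (hφ_convex : StrictConvexOn ℝ Set.univ φ)
    (E : Set PerturbedParaboloid.Plane)
    (hE_def : E = {y | PerturbedParaboloid.hessian φ y = 0})
    (hE_nonempty : E.Nonempty)
    (r₀ : ℝ) (hr₀ : 0 ≤ r₀)
    (Θ : PerturbedParaboloid.Plane → ℝ)
    (hΘ_nonneg : ∀ y, 0 ≤ Θ y)
    (hΘ_inf : ∀ r > r₀, 0 < ⨅ y : {y : PerturbedParaboloid.Plane // r < ‖y‖}, Θ y)
    (hΘ_hessian : ∀ y, (PerturbedParaboloid.hessian φ y -
      Θ y • (1 : Matrix (Fin 2) (Fin 2) ℝ)).PosSemidef)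
    (f : ℕ → PerturbedParaboloid.L2Plane)
    (hf : PerturbedParaboloid.IsExtremizing φ f) :
    (∃ y : ℕ → PerturbedParaboloid.Plane,
      (∀ n, y n ∈ E) ∧ PerturbedParaboloid.ConcentratesAlong f y) ∧
    (∀ k : ℕ → ℕ, StrictMono k →
      ∃ y₀ ∈ E ∩ Metric.closedBall 0 r₀, ∃ l : ℕ → ℕ, StrictMono l ∧
        PerturbedParaboloid.ConcentratesAt (fun n => f (k (l n))) y₀) := by

  have key : ∀ k : ℕ → ℕ, StrictMono k →
      ∃ y₀ ∈ E ∩ Metric.closedBall 0 r₀, ∃ l : ℕ → ℕ, StrictMono l ∧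
        PerturbedParaboloid.ConcentratesAt (fun n => f (k (l n))) y₀ := by
    intro k hk
    obtain ⟨y₀, hy, hr, l, hl, hconc⟩ :=
      PerturbedParaboloid.exists_subseq_concentratesAt_hessian_zero hφ_smooth hφ_convex
        (by simpa [hE_def, Set.Nonempty] using hE_nonempty) hΘ_nonneg hr₀ hΘ_inf hΘ_hessian
        (hf.comp hk)
    exact ⟨y₀, ⟨by simpa [hE_def] using hy, by simpa using hr⟩, l, hl, hconc⟩
  refine ⟨PerturbedParaboloid.exists_concentratesAlong hE_nonempty fun k hk => ?_, key⟩
  obtain ⟨y₀, hy, hl⟩ := key k hk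
  exact ⟨y₀, hy.1, hl⟩
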